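/- All graphs are finite and loopless and may contain parallel edges. A $2$-edge-coloured graph is a graph together with a map $\phi:E\to\{1,2\}$. A walk is alternating if any two consecutive edges have different colours; for a closed walk it is moreover required that it has at least one edge and that its first and last edge have different colours. A trail is a walk without repeated edges, a path is a walk without repeated vertices. Let $G$ be a $2$-edge-coloured complete graph on $n>1$ vertices $v_1,\dots,v_n$ (any two distinct vertices are joined by at least one edge), and let $p_1,\dots,p_n\ge 1$ be integers. Let $H=G[I_{p_1},\dots,I_{p_n}]$ be the extension of $G$ obtained by replacing each vertex $v_i$ by an independent set $I_{p_i}$ of $p_i$ vertices and each edge of colour $c$ between $v_i$ and $v_j$ by edges of colour $c$, one between $x$ and $y$ for every $x\in I_{p_i}$ and $y\in I_{p_j}$. Then $H$ is supereulerian if and only if $H$ has an eulerian factor and is colour-connected. Here a $2$-edge-coloured graph is - supereulerian if it contains a closed alternating trail that visits every vertex; - said to have an eulerian factor if its vertex set can be partitioned into sets $V_1,\dots,V_k$ such that the subgraph induced by each $V_i$ is supereulerian; - colour-connected if for every two distinct vertices $u,v$ there are two alternating $(u,v)$-paths $P_1,P_2$ whose union ($P_1$ from $u$ to $v$, then $P_2$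 backwards from $v$ to $u$) is an alternating closed walk. -/

import Mathlib

open scoped Graph

/-!
Multigraphs are Mathlib's `Graph α β` (vertices in `α`, edges in `β`, parallel edges allowed).
A 2-edge-colouring is a map `φ : β → Fin 2`; only its values on the edges of the graph matter.
-/

namespace TwoEdgeColoured

variable {α β : Type*}

/-- `IsWalk G u p v`: the list `p` of pairs (edge, next vertex) describes a walk of `G`
from `u` to `v`. -/
def IsWalk (G : Graph α β) : α → List (β × α) → α → Prop
  | u, [], v => u ∈ V(G) ∧ u = v
  | u, (e, w) :: p, v => G.IsLink e u w ∧ IsWalk G w p v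

/-- A trail: a walk whose edges are pairwise distinct. -/
def IsTrail (G : Graph α β) (u : α) (p : List (β × α)) (v : α) : Prop :=
  IsWalk G u p v ∧ (p.map Prod.fst).Nodup

/-- A path: a walk whose vertices are pairwise distinct. -/
def IsPath (G : Graph α β) (u : α) (p : List (β × α)) (v : α) : Prop :=
  IsWalk G u p v ∧ (u :: p.map Prod.snd).Nodup

/-- The sequence of colours of the edges of a walk. -/
def colours (φ : β → Fin 2) (p : List (β × α)) : List (Fin 2) :=
  p.map fun s => φ s.1

/-- Consecutive colours are different. -/
def Alternates (l : List (Fin 2)) : Prop :=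
  l.IsChain (· ≠ ·)

/-- Cyclic version, for closed walks: moreover the first and the last colour are different.
This fails for the empty sequence. -/
def AlternatesCyclically (l : List (Fin 2)) : Prop :=
  Alternates l ∧ l.head? ≠ l.getLast?

/-- There is a closed alternating trail (with at least one edge, the first and the last edge having
different colours) that visits every vertex. -/
def Supereulerian (G : Graph α β) (φ : β → Fin 2) : Prop :=
  ∃ (u : α) (p : List (β × α)),
    IsTrail G u p u ∧ AlternatesCyclically (colours φ p) ∧ ∀ v ∈ V(G), v ∈ p.map Prod.snd

/-- Vertex-disjoint induced subgraphs, each supereulerian, that cover all vertices. -/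
def HasEulerianFactor (G : Graph α β) (φ : β → Fin 2) : Prop :=
  ∃ (k : ℕ) (X : Fin k → Set α),
    Pairwise (Function.onFun Disjoint X) ∧ ⋃ i, X i = V(G) ∧
      ∀ i, Supereulerian (G.induce (X i)) φ

/-- Any two distinct vertices `u`, `v` are joined by two alternating `(u,v)`-paths whose union
(the first one from `u` to `v`, then the second one backwards) is an alternating closed walk. -/
def ColourConnected (G : Graph α β) (φ : β → Fin 2) : Prop :=
  ∀ u ∈ V(G), ∀ v ∈ V(G), u ≠ v →
    ∃ p q : List (β × α),
      IsPath G u p v ∧ Alternates (colours φ p) ∧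
      IsPath G u q v ∧ Alternates (colours φ q) ∧
      AlternatesCyclically (colours φ p ++ (colours φ q).reverse)

/-- A complete multigraph: no loops, and any two distinct vertices are joined by at least one
edge. -/
def IsComplete (G : Graph α β) : Prop :=
  G.Loopless ∧ ∀ u ∈ V(G), ∀ v ∈ V(G), u ≠ v → G.Adj u v

/-- The extension of `G` obtained by replacing every vertex `v` by `p v` copies `⟨v, i⟩`.
Every edge `e` of `G` joining `v` and `w` yields one edge `(e, s(x, y))` for every copy `x` of `v`
and every copy `y` of `w`. For loopless `G`, copies of the same vertex are not adjacent. -/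
def extension (G : Graph α β) (p : α → ℕ) :
    Graph (Σ v, Fin (p v)) (β × Sym2 (Σ v, Fin (p v))) where
  vertexSet := {x | x.1 ∈ V(G)}
  IsLink e x y := e.2 = s(x, y) ∧ G.IsLink e.1 x.1 y.1
  isLink_symm := fun _ _ => ⟨fun _ _ h => ⟨h.1.trans Sym2.eq_swap, h.2.symm⟩⟩
  eq_or_eq_of_isLink_of_isLink := fun _ _ _ _ _ h h' => by
    have := h.1.symm.trans h'.1
    rw [Sym2.eq_iff] at this
    exact this.imp And.left And.left
  left_mem_of_isLink := fun _ _ _ h => h.2.left_mem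

/-- The colouring of an extension: every copy of an edge `e` gets the colour of `e`. -/
def extensionColouring (φ : β → Fin 2) (p : α → ℕ) :
    β × Sym2 (Σ v, Fin (p v)) → Fin 2 :=
  fun e => φ e.1

end TwoEdgeColoured

/-! Necessity. The whole graph is its own eulerian factor. A closed alternating trail through all
vertices contains, for any u and v and either first colour, an alternating walk from u to v.
`IsExtendedComplete.exists_pathReach` replaces it by a path with the same first colour. So the pairs
(first colour, last colour) realised by (u,v)-paths form a 2×2 table without empty row or column.
Such a table contains a full diagonal, which is the required pair of paths.

Sufficiency. The closed trails of a factor are merged as long as possible. If trails on X and Y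
resist merging, two edges of one colour cannot be exchanged between them, and no alternating cycle
of length 2 or 4 runs across. Read along both trails, the colours of the cross edges form a doubly
periodic pattern. The obstructions force it to alternate along one trail and to be constant along
the other (`IsUnmergeable.eq_left_or_eq_right`), so one trail dominates the other. Cyclic domination
of three trails would give a merging 6-cycle, hence some X dominates all others (`exists_source`).
It does so with a single colour function c, since otherwise a 4-cycle merges three trails. Thus
every edge leaving X at x has colour c x.

By colour-connectedness some alternating walk from outside ends at a vertex x of X with the colour
other than c x. It must use an edge inside X whose ends have equal c and whose colour is the other
one (`AltWalk.exists_chord`). Another trail can be rerouted over this edge and joined to X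
(`hasTrail_of_chord`). Hence only one trail can remain. -/

namespace TwoEdgeColoured

/-! ### Alternating walks with prescribed first and continuing colours. -/

section Walks

variable {α β : Type*} {H : Graph α β} {φ : β → Fin 2}

lemma add_one_add_one (a : Fin 2) : a + 1 + 1 = a := by decide +revert

lemma add_one_ne (a : Fin 2) : a + 1 ≠ a := by decide +revert

lemma eq_add_one_of_ne {a b : Fin 2} (h : a ≠ b) : a = b + 1 := by decide +revert

lemma eq_or_eq_add_one (a b : Fin 2) : a = b ∨ a = b + 1 := by decide +revert

/-- An alternating walk from `u` to `v` that leaves `u` with colour `a` and that would be continued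
from `v` with colour `b`. -/
def AltWalk (H : Graph α β) (φ : β → Fin 2) : α → Fin 2 → List (β × α) → α → Fin 2 → Prop
  | u, a, [], v, b => u ∈ V(H) ∧ u = v ∧ a = b
  | u, a, (e, w) :: p, v, b => H.IsLink e u w ∧ φ e = a ∧ AltWalk H φ w (a + 1) p v b

lemma AltWalk.append {u v w : α} {a b c : Fin 2} {p q : List (β × α)}
    (hp : AltWalk H φ u a p v b) (hq : AltWalk H φ v b q w c) : AltWalk H φ u a (p ++ q) w c := by
  induction p generalizing u a with
  | nil => obtain ⟨_, rfl, rfl⟩ := hp; exact hq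
  | cons d p ih => exact ⟨hp.1, hp.2.1, ih hp.2.2⟩

lemma AltWalk.of_append {u w : α} {a c : Fin 2} {p q : List (β × α)}
    (h : AltWalk H φ u a (p ++ q) w c) (hu : u ∈ V(H)) :
    ∃ v b, AltWalk H φ u a p v b ∧ AltWalk H φ v b q w c := by
  induction p generalizing u a with
  | nil => exact ⟨u, a, ⟨hu, rfl, rfl⟩, h⟩
  | cons d p ih =>
    obtain ⟨v, b, h1, h2⟩ := ih h.2.2 h.1.right_mem
    exact ⟨v, b, ⟨h.1, h.2.1, h1⟩, h2⟩

lemma AltWalk.left_mem {u v : α} {a b : Fin 2} {p : List (β × α)}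
    (h : AltWalk H φ u a p v b) : u ∈ V(H) := by
  cases p with
  | nil => exact h.1
  | cons d p => exact h.1.left_mem

lemma AltWalk.end_mem {u v : α} {a b : Fin 2} {p : List (β × α)}
    (h : AltWalk H φ u a p v b) : v ∈ u :: p.map Prod.snd := by
  induction p generalizing u a with
  | nil => simp [h.2.1]
  | cons d p ih => exact List.mem_cons_of_mem _ (ih h.2.2)

lemma AltWalk.end_eq {u v : α} {a b : Fin 2} {p : List (β × α)} {e : β} {w : α}
    (h : AltWalk H φ u a (p ++ [(e, w)]) v b) : w = v ∧ φ e = b + 1 := by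
  induction p generalizing u a with
  | nil =>
    obtain ⟨_, h2, _, h3, h4⟩ := h
    refine ⟨h3, ?_⟩
    rw [← h4, h2, add_one_add_one]
  | cons d p ih => exact ih h.2.2

lemma AltWalk.snd_mem {u v : α} {a b : Fin 2} {p : List (β × α)}
    (h : AltWalk H φ u a p v b) : ∀ x ∈ p.map Prod.snd, x ∈ V(H) := by
  induction p generalizing u a with
  | nil => simp
  | cons d p ih =>
    intro x hx
    rcases List.mem_cons.1 hx with rfl | hx
    · exact h.1.right_mem
    · exact ih h.2.2 x hx

lemma AltWalk.exists_isLink {u v : α} {a b : Fin 2} {p : List (β × α)}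
    (h : AltWalk H φ u a p v b) {e : β} (he : e ∈ p.map Prod.fst) :
    ∃ x ∈ u :: p.map Prod.snd, ∃ y ∈ p.map Prod.snd, H.IsLink e x y := by
  induction p generalizing u a with
  | nil => simp at he
  | cons d p ih =>
    rcases List.mem_cons.1 he with rfl | he
    · exact ⟨u, by simp, d.2, by simp, h.1⟩
    · obtain ⟨x, hx, y, hy, hl⟩ := ih h.2.2 he
      exact ⟨x, List.mem_cons_of_mem _ hx, y, List.mem_cons_of_mem _ hy, hl⟩

/-- The reverse of a walk that starts in `u`. -/
def reverseWalk : α → List (β × α) → List (β × α)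
  | _, [] => []
  | u, (e, w) :: p => reverseWalk w p ++ [(e, u)]

lemma map_fst_reverseWalk (u : α) (p : List (β × α)) :
    (reverseWalk u p).map Prod.fst = (p.map Prod.fst).reverse := by
  induction p generalizing u with
  | nil => rfl
  | cons d p ih => simp [reverseWalk, ih]

lemma AltWalk.reverse {u v : α} {a b : Fin 2} {p : List (β × α)}
    (h : AltWalk H φ u a p v b) : AltWalk H φ v (b + 1) (reverseWalk u p) u (a + 1) := by
  induction p generalizing u a with
  | nil => obtain ⟨h, rfl, rfl⟩ := h; exact ⟨h, rfl, rfl⟩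
  | cons d p ih =>
    obtain ⟨h1, h2, h3⟩ := h
    have h4 := ih h3
    rw [add_one_add_one] at h4
    exact h4.append ⟨h1.symm, h2, h1.left_mem, rfl, rfl⟩

lemma AltWalk.vertices_reverse {u v : α} {a b : Fin 2} {p : List (β × α)}
    (h : AltWalk H φ u a p v b) :
    v :: (reverseWalk u p).map Prod.snd = (u :: p.map Prod.snd).reverse := by
  induction p generalizing u a with
  | nil => simp [reverseWalk, h.2.1]
  | cons d p ih =>
    have := ih h.2.2
    simp only [reverseWalk, List.map_append, List.map_cons, List.map_nil, ← List.cons_append, this]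
    simp

lemma AltWalk.isWalk {u v : α} {a b : Fin 2} {p : List (β × α)}
    (h : AltWalk H φ u a p v b) : IsWalk H u p v := by
  induction p generalizing u a with
  | nil => exact ⟨h.1, h.2.1⟩
  | cons d p ih => exact ⟨h.1, ih h.2.2⟩

lemma AltWalk.head?_colours {u v : α} {a b : Fin 2} {p : List (β × α)}
    (h : AltWalk H φ u a p v b) (hp : p ≠ []) : (colours φ p).head? = some a := by
  cases p with
  | nil => exact absurd rfl hp
  | cons d p => simp [colours, h.2.1]

lemma AltWalk.getLast?_colours {u v : α} {a b : Fin 2} {p : List (β × α)}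
    (h : AltWalk H φ u a p v b) (hp : p ≠ []) : (colours φ p).getLast? = some (b + 1) := by
  obtain ⟨q, d, rfl⟩ := (List.eq_nil_or_concat p).resolve_left hp
  simp [colours, List.concat_eq_append] at h ⊢
  exact (AltWalk.end_eq (e := d.1) (w := d.2) h).2

lemma AltWalk.alternates {u v : α} {a b : Fin 2} {p : List (β × α)}
    (h : AltWalk H φ u a p v b) : Alternates (colours φ p) := by
  induction p generalizing u a with
  | nil => exact List.isChain_nil
  | cons d p ih =>
    refine List.isChain_cons.2 ⟨?_, ih h.2.2⟩
    intro c hc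
    have hp : p ≠ [] := by rintro rfl; simp at hc
    have h1 := h.2.2.head?_colours hp
    have h2 : c = a + 1 := by
      have : (colours φ p).head? = some c := hc
      rw [h1] at this
      exact (Option.some.inj this).symm
    have h3 : φ d.1 = a := h.2.1
    rw [h2]
    exact fun h4 => add_one_ne a (h4.symm.trans h3)

lemma exists_altWalk {u v : α} {p : List (β × α)} {a : Fin 2} (h : IsWalk H u p v)
    (hp : Alternates (colours φ p)) (ha : (colours φ p).head? = some a) :
    ∃ b, AltWalk H φ u a p v b := by
  induction p generalizing u a with
  | nil => simp [colours] at ha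
  | cons d p ih =>
    have ha' : φ d.1 = a := by simpa [colours] using ha
    rcases p with _ | ⟨d', p⟩
    · exact ⟨a + 1, h.1, ha', h.2.1, h.2.2, rfl⟩
    · obtain ⟨h1, h2⟩ := List.isChain_cons.1 hp
      have h3 : φ d'.1 = a + 1 := by
        refine eq_add_one_of_ne ?_
        rw [← ha']
        exact (h1 (φ d'.1) (by simp)).symm
      obtain ⟨b, hb⟩ := ih h.2 h2 (a := a + 1) (by simp [colours, h3])
      exact ⟨b, h.1, ha', hb⟩

end Walks

/-- A 2-edge-coloured graph whose vertices are divided into classes by `κ`, such that exactly the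
vertices of different classes are adjacent and the vertices of a class look alike. -/
structure IsExtendedComplete {α β γ : Type*} (H : Graph α β) (φ : β → Fin 2) (κ : α → γ) :
    Prop where
  ne : ∀ {e x y}, H.IsLink e x y → κ x ≠ κ y
  adj : ∀ {x y}, x ∈ V(H) → y ∈ V(H) → κ x ≠ κ y → ∃ e, H.IsLink e x y
  twin : ∀ {e x y z}, H.IsLink e x y → z ∈ V(H) → κ z = κ x → ∃ f, H.IsLink f z y ∧ φ f = φ e

/-! ### Shortening alternating walks to alternating paths. -/

section Paths

variable {α β γ : Type*} {H : Graph α β} {φ : β → Fin 2} {κ : α → γ}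

lemma IsExtendedComplete.vertex_ne (hH : IsExtendedComplete H φ κ) {e : β} {x y : α}
    (h : H.IsLink e x y) : x ≠ y := fun h' => hH.ne h (by rw [h'])

/-- There is an alternating path from `u` to `v` that leaves `u` with colour `a` and that could be
continued with colour `b`. -/
def PathReach (H : Graph α β) (φ : β → Fin 2) (u : α) (a : Fin 2) (v : α) (b : Fin 2) : Prop :=
  ∃ p, p ≠ [] ∧ AltWalk H φ u a p v b ∧ (u :: p.map Prod.snd).Nodup

lemma PathReach.symm {u v : α} {a b : Fin 2} (h : PathReach H φ u a v b) :
    PathReach H φ v (b + 1) u (a + 1) := by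
  obtain ⟨p, hp, hw, hn⟩ := h
  refine ⟨reverseWalk u p, ?_, hw.reverse, ?_⟩
  · intro h0
    apply hp
    have := map_fst_reverseWalk u p
    rw [h0] at this
    simpa using this.symm
  · rw [hw.vertices_reverse]
    exact List.nodup_reverse.2 hn

lemma PathReach.single {u v : α} {e : β} (h : H.IsLink e u v) (hne : u ≠ v) :
    PathReach H φ u (φ e) v (φ e + 1) :=
  ⟨[(e, v)], by simp, ⟨h, rfl, h.right_mem, rfl, rfl⟩, by simpa using hne⟩

/-- Either the path can be prolonged to `q`, or `q` is on the path, at which point the path can be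
cut off and prolonged to its former end. -/
lemma PathReach.extend {u v q : α} {a b : Fin 2} {e : β} (h : PathReach H φ u a v b)
    (he : H.IsLink e v q) (hb : φ e = b) (hqu : q ≠ u) (hqv : q ≠ v) :
    PathReach H φ u a q (b + 1) ∨ (PathReach H φ u a q b ∧ PathReach H φ u a v (b + 1)) := by
  obtain ⟨p, hp, hw, hn⟩ := h
  by_cases hq : q ∈ p.map Prod.snd
  · obtain ⟨d, hd, rfl⟩ := List.mem_map.1 hq
    obtain ⟨s, t, rfl⟩ := List.append_of_mem hd
    rw [List.append_cons] at hw hn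
    obtain ⟨x, c, h1, h2⟩ := hw.of_append hw.left_mem
    obtain ⟨rfl, -⟩ := AltWalk.end_eq (e := d.1) (w := d.2) h1
    have hn1 : (u :: (s ++ [d]).map Prod.snd).Nodup := by
      refine hn.sublist ?_
      simp
    have hr : PathReach H φ u a d.2 c := ⟨s ++ [d], by simp, h1, hn1⟩
    -- If the path could leave `q` with the colour of `e`, then `e` leads from `q` straight to `v`,
    -- skipping the rest of the path. Otherwise the initial piece up to `q` already has the wanted
    -- end colour.
    rcases eq_or_eq_add_one c b with rfl | rfl
    · right
      refine ⟨hr, s ++ [d] ++ [(e, v)], by simp,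
        h1.append ⟨he.symm, hb, he.left_mem, rfl, rfl⟩, ?_⟩
      have hv : v ∈ t.map Prod.snd := by
        have := h2.end_mem
        rcases List.mem_cons.1 this with h | h
        · exact absurd h.symm hqv
        · exact h
      refine hn.sublist ?_
      rw [List.map_append (l₁ := s ++ [d]), List.map_append (l₁ := s ++ [d])]
      refine List.Sublist.cons_cons _ (List.Sublist.append (List.Sublist.refl _) ?_)
      simpa using hv
    · exact Or.inl hr
  · left
    refine ⟨p ++ [(e, q)], by simp, hw.append ⟨he, hb, he.right_mem, rfl, rfl⟩, ?_⟩
    rw [List.map_append, ← List.cons_append]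
    refine List.Nodup.append hn (by simp) ?_
    simp only [List.map_cons, List.map_nil, List.disjoint_singleton, List.mem_cons, not_or]
    exact ⟨hqu, hq⟩

/-- If there is no alternating path from `u` to `w` that starts with colour `a`, then the edges
between `w` and a vertex that is reached by such a path have the last colour of the path. -/
lemma IsExtendedComplete.exists_isLink_of_not_reach (hH : IsExtendedComplete H φ κ) {u w v : α}
    {a b : Fin 2} (hw : w ∈ V(H)) (huw : w ≠ u) (hno : ∀ c, ¬ PathReach H φ u a w c)
    (h : PathReach H φ u a v b) :
    (∃ e, H.IsLink e v w) ∧ ∀ e, H.IsLink e v w → φ e = b + 1 := by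
  have hvw : w ≠ v := fun h' => hno b (h' ▸ h)
  have hc : ∀ e, H.IsLink e v w → φ e = b + 1 := by
    intro e he
    by_contra hne
    have hb : φ e = b := by
      have := eq_add_one_of_ne hne
      rwa [add_one_add_one] at this
    rcases h.extend he hb huw hvw with h' | h'
    · exact hno _ h'
    · exact hno _ h'.1
  refine ⟨?_, hc⟩
  obtain ⟨p, hp, hwk, hn⟩ := h
  obtain ⟨q, ⟨e, x⟩, rfl⟩ := (List.eq_nil_or_concat p).resolve_left hp
  rw [List.concat_eq_append] at hwk hn
  obtain ⟨rfl, h3⟩ := hwk.end_eq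
  -- Were `w` in the class of the end of the path, a twin of the last edge would lead to `w`
  -- instead.
  refine hH.adj (hwk.snd_mem x (by simp)) hw fun hκ => ?_
  obtain ⟨y, c, h1, h2⟩ := hwk.of_append hwk.left_mem
  obtain ⟨f, hf, hfe⟩ := hH.twin h2.1.symm hw hκ.symm
  have hwalk : AltWalk H φ u a (q ++ [(f, w)]) w (c + 1) :=
    h1.append ⟨hf.symm, hfe.trans h2.2.1, hw, rfl, rfl⟩
  by_cases hwq : w ∈ q.map Prod.snd
  · obtain ⟨d, hd, rfl⟩ := List.mem_map.1 hwq
    obtain ⟨s, t, rfl⟩ := List.append_of_mem hd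
    rw [List.append_cons] at h1
    obtain ⟨z, c', h4, -⟩ := h1.of_append h1.left_mem
    obtain ⟨rfl, -⟩ := AltWalk.end_eq (e := d.1) (w := d.2) h4
    refine hno c' ⟨s ++ [d], by simp, h4, hn.sublist ?_⟩
    simp
  · refine hno _ ⟨q ++ [(f, w)], by simp, hwalk, ?_⟩
    rw [List.map_append, ← List.cons_append]
    refine List.Nodup.append (hn.sublist (by simp)) (by simp) ?_
    simp only [List.map_cons, List.map_nil, List.disjoint_singleton, List.mem_cons, not_or]
    exact ⟨huw, hwq⟩

/-- In an extension of a complete graph every vertex that is reached by an alternating walk is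
reached by an alternating path with the same first colour. -/
theorem IsExtendedComplete.exists_pathReach (hH : IsExtendedComplete H φ κ) {u w : α}
    {a b : Fin 2} {p : List (β × α)} (huw : w ≠ u) (hp : AltWalk H φ u a p w b) :
    ∃ c, PathReach H φ u a w c := by
  by_contra! hno
  have hw : w ∈ V(H) := hp.reverse.left_mem
  -- An edge from `v` to `w` has the last colour of every such path to `v`, so all these paths agree
  -- in it.
  have huniq : ∀ v b c, PathReach H φ u a v b → PathReach H φ u a v c → b = c := by
    intro v b c hb hc
    obtain ⟨⟨e, he⟩, h1⟩ := hH.exists_isLink_of_not_reach hw huw hno hb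
    have h2 := (hH.exists_isLink_of_not_reach hw huw hno hc).2 e he
    exact add_right_cancel ((h1 e he).symm.trans h2)
  -- Each state (vertex, next colour) of the walk is reached by a path or is the initial state, up
  -- to the end `w`. The initial state is separate because no nonempty path ends in `u`.
  have key : ∀ (q : List (β × α)) (v : α) (c : Fin 2), AltWalk H φ v c q w b →
      (PathReach H φ u a v c ∨ (v = u ∧ c = a)) → False := by
    intro q
    induction q with
    | nil =>
      rintro v c ⟨_, rfl, rfl⟩ (h | ⟨h, -⟩)
      · exact hno _ h
      · exact huw h
    | cons d q ih =>
      rintro v c ⟨h1, h2, h3⟩ hv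
      refine ih _ _ h3 ?_
      rcases hv with hv | ⟨rfl, rfl⟩
      · by_cases hqu : d.2 = u
        · right
          refine ⟨hqu, ?_⟩
          by_contra hne
          -- Otherwise the edge back to `u` has colour `a`. Traversed from `u` it is a path to `v`
          -- with the wrong last colour.
          have hca : c = a := by
            have := eq_add_one_of_ne hne
            exact add_right_cancel (this.trans rfl)
          have hs : PathReach H φ u (φ d.1) v (φ d.1 + 1) :=
            PathReach.single (hqu ▸ h1.symm) (hqu ▸ (hH.vertex_ne h1).symm)
          rw [h2, hca] at hs
          rw [hca] at hv
          exact add_one_ne a (huniq _ _ _ hs hv)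
        · rcases hv.extend h1 h2 hqu (hH.vertex_ne h1).symm with h | ⟨-, h⟩
          · exact Or.inl h
          · exact absurd (huniq _ _ _ h hv) (add_one_ne c)
      · left
        have hs : PathReach H φ v (φ d.1) d.2 (φ d.1 + 1) :=
          PathReach.single h1 (hH.vertex_ne h1)
        rwa [h2] at hs
  exact key p u a hp (Or.inr ⟨rfl, rfl⟩)

end Paths

/-! ### Periodic colour patterns between two closed trails. -/

section Periodic

lemma apply_add_mul {δ : Type*} {f : ℤ → δ} {N : ℤ} (h : ∀ i, f (i + N) = f i) (i : ℤ) (k : ℕ) :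
    f (i + k * N) = f i := by
  induction k with
  | zero => simp
  | succ k ih => rw [← ih, ← h (i + k * N)]; congr 1; push_cast; ring

/-- A colour pattern for the edges between two closed trails: `c i` and `d j` are the colours of the
edges leaving position `i` of the first and position `j` of the second trail. Edges of one colour
cannot be exchanged, and there is no alternating 4-cycle. -/
structure IsUnmergeable (f : ℤ → ℤ → Fin 2) (c d : ℤ → Fin 2) (N : ℕ) : Prop where
  pos : 0 < N
  periodic_left : ∀ i j, f (i + N) j = f i j
  periodic_right : ∀ i j, f i (j + N) = f i j
  left_succ : ∀ i, c (i + 1) = c i + 1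
  right_succ : ∀ j, d (j + 1) = d j + 1
  left_periodic : ∀ i, c (i + N) = c i
  parallel : ∀ i j, c i = d j → f i j = c i → f (i + 1) (j + 1) ≠ c i
  crossing : ∀ i j, c i = d j → f i (j + 1) = c i → f (i + 1) j ≠ c i
  nested : ∀ i i' j j', f i j ≠ f i' j → f i' j ≠ f i' j' → f i' j' ≠ f i j' → f i j' = f i j

namespace IsUnmergeable

variable {f : ℤ → ℤ → Fin 2} {c d : ℤ → Fin 2} {N : ℕ}

/-- If `f i j = c i`, this is `parallel`. Otherwise a failure means that `f` agrees with `c` at `(i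
+ 1, j + 1)`. By `parallel` the agreement propagates along the diagonal, and after a full period it
reaches `(i, j)`, where it is false. -/
lemma flip_of_eq (h : IsUnmergeable f c d N) {i j : ℤ} (hij : c i = d j) :
    f (i + 1) (j + 1) = f i j + 1 := by
  have step : ∀ t : ℕ, f (i + 1) (j + 1) = c (i + 1) →
      c (i + 1 + t) = d (j + 1 + t) ∧ f (i + 1 + t) (j + 1 + t) = c (i + 1 + t) := by
    intro t h0
    induction t with
    | zero => simpa [h.left_succ, h.right_succ, hij] using h0
    | succ t ih =>
      push_cast
      rw [← add_assoc, ← add_assoc]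
      refine ⟨by rw [h.left_succ, h.right_succ, ih.1], ?_⟩
      rw [h.left_succ]
      exact eq_add_one_of_ne (h.parallel _ _ ih.1 ih.2)
  by_cases hf : f i j = c i
  · rw [hf]
    exact eq_add_one_of_ne (h.parallel i j hij hf)
  · have h1 := eq_add_one_of_ne hf
    rw [h1, add_one_add_one]
    by_contra hne
    have h2 := eq_add_one_of_ne hne
    rw [← h.left_succ] at h2
    have h3 := (step (N - 1) h2).2
    have hN : ((N - 1 : ℕ) : ℤ) = N - 1 := by
      have := h.pos
      omega
    rw [hN, show i + 1 + ((N : ℤ) - 1) = i + N by ring,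
      show j + 1 + ((N : ℤ) - 1) = j + N by ring, h.periodic_left, h.periodic_right,
      h.left_periodic] at h3
    exact hf h3

/-- The pattern with the second trail reversed. -/
lemma reflect (h : IsUnmergeable f c d N) :
    IsUnmergeable (fun i j => f i (-j)) c (fun j => d (-j) + 1) N where
  pos := h.pos
  periodic_left _ _ := h.periodic_left _ _
  periodic_right i j := by
    rw [← h.periodic_right i (-(j + N))]
    congr 1; ring
  left_succ := h.left_succ
  right_succ j := by
    have := h.right_succ (-(j + 1))
    rw [show -(j + 1) + 1 = -j by ring] at this
    rw [this, add_one_add_one]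
  left_periodic := h.left_periodic
  parallel i j hij h1 h2 := by
    have := h.right_succ (-(j + 1))
    rw [show -(j + 1) + 1 = -j by ring] at this
    refine h.crossing i (-(j + 1)) ?_ ?_ h2
    · rw [hij, this, add_one_add_one]
    · rwa [show -(j + 1) + 1 = -j by ring]
  crossing i j hij h1 h2 := by
    have := h.right_succ (-(j + 1))
    rw [show -(j + 1) + 1 = -j by ring] at this
    refine h.parallel i (-(j + 1)) ?_ h1 ?_
    · rw [hij, this, add_one_add_one]
    · rwa [show -(j + 1) + 1 = -j by ring]
  nested i i' j j' := h.nested i i' (-j) (-j')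

lemma swap (h : IsUnmergeable f c d N) (hd : ∀ j, d (j + N) = d j) :
    IsUnmergeable (fun j i => f i j) d c N where
  pos := h.pos
  periodic_left _ _ := h.periodic_right _ _
  periodic_right _ _ := h.periodic_left _ _
  left_succ := h.right_succ
  right_succ := h.left_succ
  left_periodic := hd
  parallel j i hij h1 := by rw [hij] at h1 ⊢; exact h.parallel i j hij.symm h1
  crossing j i hij h1 h2 := by rw [hij] at h1 h2; exact h.crossing i j hij.symm h2 h1
  nested j j' i i' h1 h2 h3 := by
    have h4 := h.nested i i' j j'
    -- Both conditions say that the colours do not alternate around a 4-cycle, read in opposite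
    -- directions.
    have : ∀ p q r s : Fin 2, (p ≠ q → q ≠ s → s ≠ r → r = p) → p ≠ r → r ≠ s → s ≠ q → q = p := by
      decide
    exact this _ _ _ _ h4 h1 h2 h3

lemma flip_of_ne (h : IsUnmergeable f c d N) {i j : ℤ} (hij : c i = d j + 1) :
    f (i + 1) (j - 1) = f i j + 1 := by
  have := h.reflect.flip_of_eq (i := i) (j := -j) (by simpa using hij)
  simpa [add_comm, sub_eq_add_neg] using this

/-- Two diagonal flips carry row `i` to row `i + 2`, shifted by two columns. If the rows differ in
column `j`, then `nested` carries the value `f i j` from row `i + 2` back to row `i` in every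
column. So row `i` is constant on the columns `j + 2k`, and going once around the period removes the
difference. -/
lemma add_two_left_of_eq (h : IsUnmergeable f c d N) {i j : ℤ} (hij : c i = d j) :
    f (i + 2) j = f i j := by
  have hd : ∀ k : ℕ, d (j + 2 * k) = d j := by
    intro k
    induction k with
    | zero => simp
    | succ k ih =>
      rw [show j + 2 * ((k + 1 : ℕ) : ℤ) = j + 2 * k + 1 + 1 by push_cast; ring,
        h.right_succ, h.right_succ, add_one_add_one, ih]
  have hshift : ∀ k : ℕ, f (i + 2) (j + 2 * k + 2) = f i (j + 2 * k) := by
    intro k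
    have h1 : c i = d (j + 2 * k) := by rw [hd, hij]
    have h2 : c (i + 1) = d (j + 2 * k + 1) := by rw [h.left_succ, h.right_succ, h1]
    rw [show i + 2 = i + 1 + 1 by ring, show j + 2 * k + 2 = j + 2 * (k : ℤ) + 1 + 1 by ring,
      h.flip_of_eq h2, h.flip_of_eq h1, add_one_add_one]
  by_contra hne
  have himp : ∀ k, f (i + 2) k = f i j → f i k = f i j := by
    intro k hk
    by_contra hk'
    exact hk' (h.nested i (i + 2) j k (Ne.symm hne) (hk ▸ hne) (hk ▸ Ne.symm hk'))
  have hall : ∀ k : ℕ, f i (j + 2 * k) = f i j := by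
    intro k
    induction k with
    | zero => simp
    | succ k ih =>
      apply himp
      rw [← ih, ← hshift k]
      congr 1; push_cast; ring
  have h1 := hshift (N - 1)
  rw [hall] at h1
  have hN : ((N - 1 : ℕ) : ℤ) = N - 1 := by
    have := h.pos
    omega
  rw [hN, show j + 2 * ((N : ℤ) - 1) + 2 = j + N + N by ring, h.periodic_right,
    h.periodic_right] at h1
  exact hne h1

lemma add_two_left (h : IsUnmergeable f c d N) (i j : ℤ) : f (i + 2) j = f i j := by
  rcases eq_or_eq_add_one (c i) (d j) with hij | hij
  · exact h.add_two_left_of_eq hij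
  · simpa using h.reflect.add_two_left_of_eq (i := i) (j := -j) (by simpa using hij)

lemma add_two_right (h : IsUnmergeable f c d N) (hd : ∀ j, d (j + N) = d j) (i j : ℤ) :
    f i (j + 2) = f i j := (h.swap hd).add_two_left j i

/-- The colours of the edges between the two trails depend only on the end in one of the trails, and
they alternate along this trail. -/
theorem eq_left_or_eq_right (h : IsUnmergeable f c d N) (hd : ∀ j, d (j + N) = d j) :
    (∃ a, ∀ i j, f i j = c i + a) ∨ (∃ a, ∀ i j, f i j = d j + a) := by
  obtain ⟨i₀, h0⟩ : ∃ i₀, c i₀ = d 0 := by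
    rcases eq_or_eq_add_one (c 0) (d 0) with h0 | h0
    · exact ⟨0, h0⟩
    · exact ⟨0 + 1, by rw [h.left_succ, h0, add_one_add_one]⟩
  have hc2 : ∀ i, c (i + 2) = c i := fun i => by
    rw [show i + 2 = i + 1 + 1 by ring, h.left_succ, h.left_succ, add_one_add_one]
  have hd2 : ∀ i, d (i + 2) = d i := fun i => by
    rw [show i + 2 = i + 1 + 1 by ring, h.right_succ, h.right_succ, add_one_add_one]
  -- A property of period two holds everywhere once it holds at two consecutive integers.
  have par : ∀ {P : ℤ → Prop} (k : ℤ), (∀ i, P (i + 2) ↔ P i) → P k → P (k + 1) → ∀ i, P i := by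
    intro P k hP h0 h1
    have hup : ∀ n : ℕ, P (k + n) ∧ P (k + n + 1) := by
      intro n
      induction n with
      | zero => simpa using ⟨h0, h1⟩
      | succ n ih =>
        push_cast
        rw [← add_assoc]
        refine ⟨ih.2, ?_⟩
        rw [add_assoc]
        exact (hP _).2 ih.1
    have hdown : ∀ n : ℕ, P (k - n) ∧ P (k - n + 1) := by
      intro n
      induction n with
      | zero => simpa using ⟨h0, h1⟩
      | succ n ih =>
        push_cast
        rw [show k - (n + 1 : ℤ) + 1 = k - n by ring]
        refine ⟨?_, ih.1⟩
        rw [← hP, show k - (n + 1 : ℤ) + 2 = k - n + 1 by ring]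
        exact ih.2
    intro i
    rcases le_total k i with hi | hi
    · have := (hup (i - k).toNat).1
      rwa [Int.toNat_of_nonneg (by omega), add_sub_cancel] at this
    · have := (hdown (k - i).toNat).1
      rwa [Int.toNat_of_nonneg (by omega), sub_sub_cancel] at this
  have h11 := h.flip_of_eq h0
  have h10 : f (i₀ + 1) 0 = f i₀ 1 + 1 := by
    have := h.flip_of_ne (i := i₀) (j := 0 + 1) (by rw [h.right_succ, add_one_add_one, h0])
    simpa using this
  have hd1 := h.right_succ 0
  have hc1 := h.left_succ i₀
  rw [zero_add] at h11 hd1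
  -- By 2-periodicity a 2×2 block determines `f`. Both diagonals of the block flip, so comparing the
  -- entries of its first row decides on which index `f` depends.
  rcases eq_or_eq_add_one (f i₀ 1) (f i₀ 0) with hq | hq
  · left
    refine ⟨f i₀ 0 - c i₀, ?_⟩
    refine par i₀ (fun i => ?_) (par 0 (fun j => ?_) ?_ ?_) (par 0 (fun j => ?_) ?_ ?_)
    · simp only [h.add_two_left, hc2]
    · rw [h.add_two_right hd]
    · abel
    · rw [zero_add, hq]; abel
    · rw [h.add_two_right hd]
    · rw [h10, hq, hc1]; abel
    · rw [zero_add, h11, hc1]; abel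
  · right
    refine ⟨f i₀ 0 - d 0, ?_⟩
    refine par i₀ (fun i => ?_) (par 0 (fun j => ?_) ?_ ?_) (par 0 (fun j => ?_) ?_ ?_)
    · simp only [h.add_two_left]
    · rw [h.add_two_right hd, hd2]
    · abel
    · rw [zero_add, hq, hd1]; abel
    · rw [h.add_two_right hd, hd2]
    · rw [h10, hq, add_one_add_one]; abel
    · rw [zero_add, h11, hd1]; abel

end IsUnmergeable

end Periodic

/-! ### Closed alternating trails and how to merge them. -/

section ClosedTrails

variable {α β γ : Type*} {H : Graph α β} {φ : β → Fin 2} {κ : α → γ}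

/-- A closed alternating trail `p` that starts in `u` with colour `a`, visits exactly the vertices
of `X` and uses exactly the edges of `F`. -/
structure IsClosedTrail (H : Graph α β) (φ : β → Fin 2) (u : α) (a : Fin 2) (p : List (β × α))
    (X : Set α) (F : Set β) : Prop where
  ne_nil : p ≠ []
  walk : AltWalk H φ u a p u a
  nodup : (p.map Prod.fst).Nodup
  mem_iff : ∀ w, w ∈ p.map Prod.snd ↔ w ∈ X
  edge_iff : ∀ e, e ∈ p.map Prod.fst ↔ e ∈ F

/-- There is a closed alternating trail with vertex set `X` and edge set `F`. -/
def HasTrail (H : Graph α β) (φ : β → Fin 2) (X : Set α) (F : Set β) : Prop :=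
  ∃ u a p, IsClosedTrail H φ u a p X F

lemma AltWalk.hasTrail {u : α} {a : Fin 2} {p : List (β × α)} (h : AltWalk H φ u a p u a)
    (hp : p ≠ []) (hn : (p.map Prod.fst).Nodup) :
    HasTrail H φ {w | w ∈ p.map Prod.snd} {e | e ∈ p.map Prod.fst} :=
  ⟨u, a, p, hp, h, hn, fun _ => Iff.rfl, fun _ => Iff.rfl⟩

namespace IsClosedTrail

variable {u v : α} {a b : Fin 2} {p q : List (β × α)} {X Y : Set α} {F F' : Set β}

lemma of_perm (h : IsClosedTrail H φ u a p X F) (hpq : p.Perm q) (hq : AltWalk H φ v b q v b) :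
    IsClosedTrail H φ v b q X F where
  ne_nil h0 := h.ne_nil (by rw [h0] at hpq; exact hpq.eq_nil)
  walk := hq
  nodup := (hpq.map _).nodup_iff.1 h.nodup
  mem_iff w := by rw [← h.mem_iff, (hpq.map Prod.snd).mem_iff]
  edge_iff w := by rw [← h.edge_iff, (hpq.map Prod.fst).mem_iff]

lemma rotate_append (h : IsClosedTrail H φ u a (p ++ q) X F) :
    ∃ v b, AltWalk H φ u a p v b ∧ IsClosedTrail H φ v b (q ++ p) X F := by
  obtain ⟨v, b, h1, h2⟩ := h.walk.of_append h.walk.left_mem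
  exact ⟨v, b, h1, h.of_perm List.perm_append_comm (h2.append h1)⟩

lemma reverse (h : IsClosedTrail H φ u a p X F) :
    IsClosedTrail H φ u (a + 1) (reverseWalk u p) X F where
  ne_nil h0 := by
    have := map_fst_reverseWalk u p
    rw [h0] at this
    exact h.ne_nil (by simpa using this.symm)
  walk := h.walk.reverse
  nodup := by
    rw [map_fst_reverseWalk]
    exact List.nodup_reverse.2 h.nodup
  mem_iff w := by
    have h1 : (u :: (reverseWalk u p).map Prod.snd).Perm (u :: p.map Prod.snd) := by
      rw [h.walk.vertices_reverse]
      exact List.reverse_perm _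
    rw [← h.mem_iff, h1.cons_inv.mem_iff]
  edge_iff e := by rw [← h.edge_iff, map_fst_reverseWalk, List.mem_reverse]

/-- The same first edge is traversed backwards, with the same colour in front. This provides the
second way of exchanging it against an edge of another trail. -/
lemma reverse_cons {e : β} {w : α} (h : IsClosedTrail H φ u a ((e, w) :: p) X F) :
    IsClosedTrail H φ w a ((e, u) :: reverseWalk w p) X F := by
  refine h.reverse.of_perm (List.perm_append_comm (l₂ := [(e, u)])) ?_
  refine ⟨h.walk.1.symm, h.walk.2.1, ?_⟩
  simpa [add_one_add_one] using h.walk.2.2.reverse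

/-- Rotation brings `v` to the front with one of the two first colours; reversal gives the other. -/
lemma rebase (h : IsClosedTrail H φ u a p X F) (hv : v ∈ X) (b : Fin 2) :
    ∃ q, IsClosedTrail H φ v b q X F := by
  rw [← h.mem_iff] at hv
  obtain ⟨d, hd, rfl⟩ := List.mem_map.1 hv
  obtain ⟨s, t, rfl⟩ := List.append_of_mem hd
  rw [List.append_cons] at h
  obtain ⟨v, c, h1, h2⟩ := h.rotate_append
  obtain ⟨rfl, -⟩ := AltWalk.end_eq (e := d.1) (w := d.2) h1
  rcases eq_or_eq_add_one b c with rfl | rfl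
  · exact ⟨_, h2⟩
  · exact ⟨_, h2.reverse⟩

lemma start_mem (h : IsClosedTrail H φ u a p X F) : u ∈ X := by
  obtain ⟨q, ⟨e, x⟩, rfl⟩ := (List.eq_nil_or_concat p).resolve_left h.ne_nil
  have hw := h.walk
  rw [List.concat_eq_append] at hw
  rw [← h.mem_iff, ← hw.end_eq.1]
  simp

lemma mem_of_isLink (h : IsClosedTrail H φ u a p X F) {e : β} {x y : α} (he : e ∈ F)
    (hl : H.IsLink e x y) : x ∈ X ∧ y ∈ X := by
  have hu := h.start_mem
  rw [← h.edge_iff] at he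
  obtain ⟨x', hx', y', hy', hl'⟩ := h.walk.exists_isLink he
  have hx : x' ∈ X := by
    rcases List.mem_cons.1 hx' with rfl | hx'
    · exact hu
    · exact (h.mem_iff _).1 hx'
  have hy : y' ∈ X := (h.mem_iff _).1 hy'
  rcases hl.eq_and_eq_or_eq_and_eq hl' with ⟨rfl, rfl⟩ | ⟨rfl, rfl⟩
  · exact ⟨hx, hy⟩
  · exact ⟨hy, hx⟩

end IsClosedTrail

namespace HasTrail

variable {X Y Z U : Set α} {F F' F'' FU : Set β}

lemma exists_isClosedTrail (h : HasTrail H φ X F) {v : α} (hv : v ∈ X) (b : Fin 2) :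
    ∃ q, IsClosedTrail H φ v b q X F := by
  obtain ⟨u, a, p, hp⟩ := h
  exact hp.rebase hv b

lemma exists_isClosedTrail_cons (h : HasTrail H φ X F) {v : α} (hv : v ∈ X) (b : Fin 2) :
    ∃ e w q, IsClosedTrail H φ v b ((e, w) :: q) X F := by
  obtain ⟨q, hq⟩ := h.exists_isClosedTrail hv b
  obtain ⟨d, q, rfl⟩ := List.exists_cons_of_ne_nil hq.ne_nil
  exact ⟨d.1, d.2, q, hq⟩

lemma nonempty (h : HasTrail H φ X F) : X.Nonempty := by
  obtain ⟨u, a, p, hp⟩ := h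
  exact ⟨u, hp.start_mem⟩

lemma subset (h : HasTrail H φ X F) : X ⊆ V(H) := by
  obtain ⟨u, a, p, hp⟩ := h
  intro x hx
  exact hp.walk.snd_mem x ((hp.mem_iff x).2 hx)

lemma mem_of_isLink (h : HasTrail H φ X F) {e : β} {x y : α} (he : e ∈ F)
    (hl : H.IsLink e x y) : x ∈ X ∧ y ∈ X := by
  obtain ⟨u, a, p, hp⟩ := h
  exact hp.mem_of_isLink he hl

lemma exists_isLink (h : HasTrail H φ X F) {e : β} (he : e ∈ F) : ∃ x y, H.IsLink e x y := by
  obtain ⟨u, a, p, hp⟩ := h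
  obtain ⟨x, -, y, -, hl⟩ := hp.walk.exists_isLink ((hp.edge_iff e).2 he)
  exact ⟨x, y, hl⟩

lemma notMem_edges (h : HasTrail H φ X F) {e : β} {x y : α} (hl : H.IsLink e x y)
    (hxy : x ∉ X ∨ y ∉ X) : e ∉ F := fun he => by
  have := h.mem_of_isLink he hl
  tauto

lemma disjoint_edges (h : HasTrail H φ X F) (h' : HasTrail H φ Y F') (hXY : Disjoint X Y) :
    Disjoint F F' := by
  rw [Set.disjoint_left]
  intro e he
  obtain ⟨x, y, hl⟩ := h.exists_isLink he
  exact h'.notMem_edges hl (Or.inl (Set.disjoint_left.1 hXY (h.mem_of_isLink he hl).1))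

/-- Closed alternating trails without common edges are joined at a common vertex. -/
lemma union (h : HasTrail H φ X F) (h' : HasTrail H φ Y F') (hF : Disjoint F F')
    (hXY : (X ∩ Y).Nonempty) : HasTrail H φ (X ∪ Y) (F ∪ F') := by
  obtain ⟨v, hX, hY⟩ := hXY
  obtain ⟨p, hp⟩ := h.exists_isClosedTrail hX 0
  obtain ⟨q, hq⟩ := h'.exists_isClosedTrail hY 0
  refine ⟨v, 0, p ++ q, ?_, hp.walk.append hq.walk, ?_, ?_, ?_⟩
  · simp [hp.ne_nil]
  · rw [List.map_append]
    refine List.Nodup.append hp.nodup hq.nodup ?_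
    intro e h1 h2
    exact Set.disjoint_left.1 hF ((hp.edge_iff e).1 h1) ((hq.edge_iff e).1 h2)
  · intro w
    rw [List.map_append, List.mem_append, hp.mem_iff, hq.mem_iff]; rfl
  · intro w
    rw [List.map_append, List.mem_append, hp.edge_iff, hq.edge_iff]; rfl

/-- A closed alternating trail through two disjoint ones that uses none of their edges
connects them. -/
lemma bridge (hU : HasTrail H φ U FU) (h : HasTrail H φ X F) (h' : HasTrail H φ Y F')
    (hXY : Disjoint X Y) (hF : Disjoint FU F) (hF' : Disjoint FU F') (hX : (U ∩ X).Nonempty)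
    (hY : (U ∩ Y).Nonempty) : HasTrail H φ (U ∪ X ∪ Y) (FU ∪ F ∪ F') := by
  refine (hU.union h hF hX).union h' ?_ (hY.mono ?_)
  · exact Set.disjoint_union_left.2 ⟨hF', h.disjoint_edges h' hXY⟩
  · exact Set.inter_subset_inter_left _ Set.subset_union_left

end HasTrail

/-- Two edges `u u'` and `v v'` of the same colour in disjoint closed alternating trails are
replaced by edges `u v'` and `v u'` of this colour. -/
lemma IsClosedTrail.exchange {u u' v v' : α} {a : Fin 2} {p q : List (β × α)} {X Y : Set α}
    {F F' : Set β} {e f g g' : β} (hp : IsClosedTrail H φ u a ((e, u') :: p) X F)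
    (hq : IsClosedTrail H φ v a ((f, v') :: q) Y F') (hXY : Disjoint X Y) (hu : u ≠ u')
    (hg : H.IsLink g u v') (hga : φ g = a) (hg' : H.IsLink g' v u') (hga' : φ g' = a) :
    ∃ F₁, HasTrail H φ (X ∪ Y) F₁ := by
  have hX := hp.start_mem
  have hY := hq.start_mem
  have hX' : u' ∈ X := (hp.mem_iff u').1 (by simp)
  have hY' : v' ∈ Y := (hq.mem_iff v').1 (by simp)
  have hYn : ∀ {y}, y ∈ Y → y ∉ X := fun h1 h2 => Set.disjoint_left.1 hXY h2 h1
  have hXn : ∀ {x}, x ∈ X → x ∉ Y := fun h1 => Set.disjoint_left.1 hXY h1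
  -- The new route is `u`, `v'`, along `q` to `v`, then `u'`, along `p` back to `u`.
  have hwalk : AltWalk H φ u a ((g, v') :: q ++ (g', u') :: p) u a :=
    AltWalk.append ⟨hg, hga, hq.walk.2.2⟩ ⟨hg', hga', hp.walk.2.2⟩
  have hnp := hp.nodup
  have hnq := hq.nodup
  rw [List.map_cons, List.nodup_cons] at hnp hnq
  have hpF : ∀ x ∈ p.map Prod.fst, x ∈ F := fun x hx => (hp.edge_iff x).1 (by simp [hx])
  have hqF : ∀ x ∈ q.map Prod.fst, x ∈ F' := fun x hx => (hq.edge_iff x).1 (by simp [hx])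
  have hTp : HasTrail H φ X F := ⟨_, _, _, hp⟩
  have hTq : HasTrail H φ Y F' := ⟨_, _, _, hq⟩
  have hgF := hTp.notMem_edges hg (Or.inr (hYn hY'))
  have hgF' := hTq.notMem_edges hg (Or.inl (hXn hX))
  have hgG := hTp.notMem_edges hg' (Or.inl (hYn hY))
  have hgG' := hTq.notMem_edges hg' (Or.inr (hXn hX'))
  have hgg : g ≠ g' := by
    rintro rfl
    rcases hg.left_eq_or_eq hg' with h1 | h1
    · exact hXn hX (h1 ▸ hY)
    · exact hu h1
  have hT := hwalk.hasTrail (by simp) (by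
    rw [List.map_append, List.map_cons, List.map_cons]
    refine List.Nodup.append (List.nodup_cons.2 ⟨fun h => hgF' (hqF _ h), hnq.2⟩)
      (List.nodup_cons.2 ⟨fun h => hgG (hpF _ h), hnp.2⟩) ?_
    intro x hx hx'
    rcases List.mem_cons.1 hx with rfl | hx <;> rcases List.mem_cons.1 hx' with h1 | hx'
    · exact hgg h1
    · exact hgF (hpF _ hx')
    · exact hgG' ((show x = g' from h1) ▸ hqF _ hx)
    · exact Set.disjoint_left.1 (hTp.disjoint_edges hTq hXY) (hpF _ hx') (hqF _ hx))
  have hset : {w | w ∈ ((g, v') :: q ++ (g', u') :: p).map Prod.snd} = X ∪ Y := by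
    ext w
    have h1 := hp.mem_iff w
    have h2 := hq.mem_iff w
    rw [List.map_cons] at h1 h2
    simp only [Set.mem_union, Set.mem_ofPred_eq, List.map_append, List.map_cons, List.mem_append,
      h1, h2, or_comm]
  exact ⟨_, hset ▸ hT⟩

/-! ### Closed trails as periodic sequences indexed by the integers. -/

section Orbits

/-- Reducing the index modulo `L` extends the iterates to negative indices, although `g` need not be
invertible. -/
lemma exists_int_orbit {S : Type*} (g : S → S) (s : S) {L : ℕ} (hL : 0 < L) (h : g^[L] s = s) :
    ∃ T : ℤ → S, (∀ n : ℕ, T n = g^[n] s) ∧ (∀ i, T (i + 1) = g (T i)) ∧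
      (∀ i, T (i + L) = T i) ∧ ∀ i, ∃ n : ℕ, T i = g^[n] s := by
  have hper : Function.IsPeriodicPt g L s := h
  have hnat : ∀ n : ℕ, g^[((n : ℤ) % L).toNat] s = g^[n] s := fun n => by
    rw [← hper.iterate_mod_apply n]
    rfl
  refine ⟨fun i => g^[(i % L).toNat] s, hnat, fun i => ?_, fun i => ?_, fun i => ⟨_, rfl⟩⟩
  · obtain ⟨m, hm⟩ : ∃ m : ℕ, i % L = m := Int.eq_ofNat_of_zero_le (Int.emod_nonneg _ (by omega))
    have h1 : (i + 1) % L = ((m + 1 : ℕ) : ℤ) % L := by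
      rw [Int.add_emod, hm]
      push_cast
      rw [Int.add_emod_emod]
    simp only [h1, hnat, hm, Int.toNat_natCast, Function.iterate_succ_apply']
  · simp

/-- Move the start of a closed walk one step further. -/
def rotateStep : α × Fin 2 × List (β × α) → α × Fin 2 × List (β × α)
  | (u, a, []) => (u, a, [])
  | (_, a, (e, w) :: p) => (w, a + 1, p ++ [(e, w)])

lemma AltWalk.iterate_rotateStep {u v : α} {a b : Fin 2} {p : List (β × α)}
    (h : AltWalk H φ u a p v b) (q : List (β × α)) :
    rotateStep^[p.length] (u, a, p ++ q) = (v, b, q ++ p) := by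
  induction p generalizing u a q with
  | nil => obtain ⟨_, rfl, rfl⟩ := h; simp
  | cons d p ih =>
    rw [List.length_cons, Function.iterate_succ_apply]
    have := ih h.2.2 (q ++ [d])
    simpa [rotateStep] using this

/-- The vertices `x i` of a closed alternating trail and the colours `c i` of the edges leaving them,
as periodic sequences. -/
lemma HasTrail.exists_sequence {X : Set α} {F : Set β} (h : HasTrail H φ X F) :
    ∃ (N : ℕ) (x : ℤ → α) (c : ℤ → Fin 2), 0 < N ∧ (∀ i, x (i + N) = x i) ∧
      (∀ i, c (i + N) = c i) ∧ (∀ i, c (i + 1) = c i + 1) ∧ (∀ w ∈ X, ∃ i, x i = w) ∧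
      (∀ e ∈ F, ∃ i, H.IsLink e (x i) (x (i + 1))) ∧
      ∀ i, ∃ e q, IsClosedTrail H φ (x i) (c i) ((e, x (i + 1)) :: q) X F := by
  obtain ⟨u, a, p, hp⟩ := h
  have hL : 0 < p.length := List.length_pos_iff.2 hp.ne_nil
  have hit := hp.walk.iterate_rotateStep []
  rw [List.append_nil, List.nil_append] at hit
  obtain ⟨T, hT0, hT1, hT2, hT3⟩ := exists_int_orbit rotateStep (u, a, p) hL hit
  have hinv : ∀ n : ℕ, ∀ t, t = rotateStep^[n] (u, a, p) →
      IsClosedTrail H φ t.1 t.2.1 t.2.2 X F := by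
    intro n
    induction n with
    | zero => rintro t rfl; exact hp
    | succ n ih =>
      rintro t rfl
      rw [Function.iterate_succ_apply']
      have := ih _ rfl
      generalize rotateStep^[n] (u, a, p) = t at this ⊢
      obtain ⟨v, b, q⟩ := t
      rcases q with _ | ⟨d, q⟩
      · exact absurd rfl this.ne_nil
      · refine this.of_perm (List.perm_append_comm (l₁ := [d])) ?_
        exact this.walk.2.2.append ⟨this.walk.1, this.walk.2.1, this.walk.1.right_mem, rfl, rfl⟩
  have hTi : ∀ i, ∃ e q, (T i).2.2 = (e, (T (i + 1)).1) :: q ∧ (T (i + 1)).2.1 = (T i).2.1 + 1 ∧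
      IsClosedTrail H φ (T i).1 (T i).2.1 (T i).2.2 X F := by
    intro i
    obtain ⟨n, hn⟩ := hT3 i
    have h1 := hinv n _ hn
    rw [hT1]
    clear hn
    generalize T i = t at h1 ⊢
    obtain ⟨v, b, q⟩ := t
    rcases q with _ | ⟨d, q⟩
    · exact absurd rfl h1.ne_nil
    · exact ⟨d.1, q, rfl, rfl, h1⟩
  refine ⟨p.length, fun i => (T i).1, fun i => (T i).2.1, hL, fun i => by simp only [hT2],
    fun i => by simp only [hT2], fun i => ?_, ?_, ?_, ?_⟩
  · obtain ⟨e, q, -, h1, -⟩ := hTi i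
    exact h1
  · intro w hw
    rw [← hp.mem_iff] at hw
    obtain ⟨d, hd, rfl⟩ := List.mem_map.1 hw
    obtain ⟨s, t, rfl⟩ := List.append_of_mem hd
    rw [List.append_cons] at hT0 hp
    obtain ⟨v, b, h1, -⟩ := hp.walk.of_append hp.walk.left_mem
    obtain ⟨rfl, -⟩ := AltWalk.end_eq (e := d.1) (w := d.2) h1
    refine ⟨((s ++ [d]).length : ℕ), ?_⟩
    simp only [hT0, h1.iterate_rotateStep]
  · intro e he
    rw [← hp.edge_iff] at he
    obtain ⟨d, hd, rfl⟩ := List.mem_map.1 he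
    obtain ⟨s, t, rfl⟩ := List.append_of_mem hd
    obtain ⟨v, b, h1, -⟩ := hp.walk.of_append hp.walk.left_mem
    refine ⟨(s.length : ℕ), ?_⟩
    obtain ⟨e, q, h2, -, h3⟩ := hTi (s.length : ℕ)
    have h4 : (T (s.length : ℕ)).2.2 = d :: t ++ s := by rw [hT0, h1.iterate_rotateStep]
    rw [h2] at h3
    rw [h2, List.cons_append, List.cons.injEq] at h4
    rw [← h4.1]
    exact h3.walk.1
  · intro i
    obtain ⟨e, q, h1, -, h2⟩ := hTi i
    rw [h1] at h2
    exact ⟨e, q, h2⟩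

end Orbits

end ClosedTrails

/-! ### Two trails that cannot be merged. -/

section Domination

variable {α β γ : Type*} {H : Graph α β} {φ : β → Fin 2} {κ : α → γ}

lemma ne_of_isLink {e f : β} {x y x' y' : α} (he : H.IsLink e x y) (hf : H.IsLink f x' y')
    (h1 : x ≠ x') (h2 : x ≠ y') : e ≠ f := by
  rintro rfl
  exact (he.left_eq_or_eq hf).elim h1 h2

lemma ne_of_colour {e f : β} {a : Fin 2} (he : φ e = a) (hf : φ f = a + 1) : e ≠ f := by
  rintro rfl
  exact add_one_ne a (hf.symm.trans he)

namespace HasTrail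

variable {X Y Z U : Set α} {F F' F'' FU : Set β}

lemma disjoint_of_cross (h : HasTrail H φ X F)
    (hc : ∀ e ∈ FU, ∃ x y, H.IsLink e x y ∧ (x ∉ X ∨ y ∉ X)) : Disjoint FU F := by
  rw [Set.disjoint_left]
  intro e he
  obtain ⟨x, y, hl, hxy⟩ := hc e he
  exact h.notMem_edges hl hxy

lemma bridge_of_cross (hU : HasTrail H φ U FU) (h : HasTrail H φ X F) (h' : HasTrail H φ Y F')
    (hXY : Disjoint X Y) (hc : ∀ e ∈ FU, ∃ x ∈ X, ∃ y ∈ Y, H.IsLink e x y) (hUXY : U ⊆ X ∪ Y)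
    {u v : α} (hu : u ∈ U) (huX : u ∈ X) (hv : v ∈ U) (hvY : v ∈ Y) :
    ∃ F₁, HasTrail H φ (X ∪ Y) F₁ := by
  have h1 := hU.bridge h h' hXY
    (h.disjoint_of_cross fun e he => by
      obtain ⟨x, hx, y, hy, hl⟩ := hc e he
      exact ⟨x, y, hl, Or.inr fun hy' => Set.disjoint_left.1 hXY hy' hy⟩)
    (h'.disjoint_of_cross fun e he => by
      obtain ⟨x, hx, y, hy, hl⟩ := hc e he
      exact ⟨x, y, hl, Or.inl fun hx' => Set.disjoint_left.1 hXY hx hx'⟩)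
    ⟨u, hu, huX⟩ ⟨v, hv, hvY⟩
  rw [Set.union_assoc, Set.union_eq_self_of_subset_left hUXY] at h1
  exact ⟨_, h1⟩

lemma bridge_three (hU : HasTrail H φ U FU) (h : HasTrail H φ X F) (h' : HasTrail H φ Y F')
    (h'' : HasTrail H φ Z F'') (hXY : Disjoint X Y) (hXZ : Disjoint X Z) (hYZ : Disjoint Y Z)
    (hc : ∀ e ∈ FU, ∃ x y, H.IsLink e x y ∧
      (x ∈ X ∧ y ∈ Y ∨ x ∈ Y ∧ y ∈ Z ∨ x ∈ X ∧ y ∈ Z)) (hUXYZ : U ⊆ X ∪ Y ∪ Z)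
    {u v w : α} (hu : u ∈ U) (huX : u ∈ X) (hv : v ∈ U) (hvY : v ∈ Y) (hw : w ∈ U) (hwZ : w ∈ Z) :
    ∃ F₁, HasTrail H φ (X ∪ Y ∪ Z) F₁ := by
  rw [Set.disjoint_left] at hXY hXZ hYZ
  have hd : Disjoint FU F := h.disjoint_of_cross fun e he => by
    obtain ⟨x, y, hl, hxy⟩ := hc e he
    exact ⟨x, y, hl, by have := @hXY; have := @hXZ; grind⟩
  have hd' : Disjoint FU F' := h'.disjoint_of_cross fun e he => by
    obtain ⟨x, y, hl, hxy⟩ := hc e he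
    exact ⟨x, y, hl, by have := @hXY; have := @hYZ; grind⟩
  have hd'' : Disjoint FU F'' := h''.disjoint_of_cross fun e he => by
    obtain ⟨x, y, hl, hxy⟩ := hc e he
    exact ⟨x, y, hl, by have := @hXZ; have := @hYZ; grind⟩
  rw [← Set.disjoint_left] at hXY hXZ hYZ
  have h1 := (hU.bridge h h' hXY hd hd' ⟨u, hu, huX⟩ ⟨v, hv, hvY⟩).union h''
    (by
      rw [Set.disjoint_union_left, Set.disjoint_union_left]
      exact ⟨⟨hd'', h.disjoint_edges h'' hXZ⟩, h'.disjoint_edges h'' hYZ⟩)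
    ⟨w, Or.inl (Or.inl hw), hwZ⟩
  rw [Set.union_assoc, Set.union_assoc, Set.union_eq_self_of_subset_left
    (by rwa [← Set.union_assoc]), ← Set.union_assoc] at h1
  exact ⟨_, h1⟩

end HasTrail

lemma hasTrail_four_cycle {x y x' y' : α} {e₁ e₂ e₃ e₄ : β} {a : Fin 2}
    (h₁ : H.IsLink e₁ x y) (h₂ : H.IsLink e₂ y x') (h₃ : H.IsLink e₃ x' y')
    (h₄ : H.IsLink e₄ y' x) (c₁ : φ e₁ = a) (c₂ : φ e₂ = a + 1) (c₃ : φ e₃ = a)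
    (c₄ : φ e₄ = a + 1) (h₁₃ : e₁ ≠ e₃) (h₂₄ : e₂ ≠ e₄) :
    HasTrail H φ {y, x', y', x} {e₁, e₂, e₃, e₄} := by
  refine ⟨x, a, [(e₁, y), (e₂, x'), (e₃, y'), (e₄, x)], by simp, ?_, ?_, by simp, by simp⟩
  · simp only [AltWalk, add_one_add_one]
    exact ⟨h₁, c₁, h₂, c₂, h₃, c₃, h₄, c₄, h₁.left_mem, trivial, trivial⟩
  · simp [h₁₃, h₂₄, ne_of_colour c₁ c₂, ne_of_colour c₁ c₄, (ne_of_colour c₃ c₂).symm,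
      ne_of_colour c₃ c₄]

/-- Every vertex `x` of `X` is adjacent to all vertices of `Y`, by edges of a single colour `c x`,
and `c` alternates along the edges of `F`. -/
def Dominates (H : Graph α β) (φ : β → Fin 2) (X : Set α) (F : Set β) (Y : Set α)
    (c : α → Fin 2) : Prop :=
  (∀ x ∈ X, ∀ y ∈ Y, (∃ e, H.IsLink e x y) ∧ ∀ e, H.IsLink e x y → φ e = c x) ∧
    ∀ e ∈ F, ∀ x y, H.IsLink e x y → c y = c x + 1

/-- A trail may pass a vertex several times, so `c` is a function of positions. Colours towards the
fixed `y₀` turn it into a function of vertices. -/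
lemma dominates_of_sequence {X Y : Set α} {F : Set β} {x : ℤ → α} {c : ℤ → Fin 2} {a : Fin 2}
    {col : α → α → Fin 2} {y₀ : α} (hy₀ : y₀ ∈ Y)
    (hc : ∀ i, c (i + 1) = c i + 1) (hx : ∀ w ∈ X, ∃ i, x i = w)
    (hF : ∀ e ∈ F, ∃ i, H.IsLink e (x i) (x (i + 1)))
    (hadj : ∀ x ∈ X, ∀ y ∈ Y, (∃ e, H.IsLink e x y) ∧ ∀ e, H.IsLink e x y → φ e = col x y)
    (hcol : ∀ i, ∀ y ∈ Y, col (x i) y = c i + a) :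
    Dominates H φ X F Y fun x => col x y₀ := by
  refine ⟨fun v hv y hy => ⟨(hadj v hv y hy).1, fun e he => ?_⟩, fun e he v w hl => ?_⟩
  · obtain ⟨i, rfl⟩ := hx v hv
    exact ((hadj _ hv y hy).2 e he).trans ((hcol i y hy).trans (hcol i y₀ hy₀).symm)
  · obtain ⟨i, hi⟩ := hF e he
    have h1 : col (x (i + 1)) y₀ = col (x i) y₀ + 1 := by
      rw [hcol _ y₀ hy₀, hcol _ y₀ hy₀, hc]; abel
    rcases hl.eq_and_eq_or_eq_and_eq hi with ⟨rfl, rfl⟩ | ⟨rfl, rfl⟩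
    · exact h1
    · simp only
      rw [h1, add_one_add_one]

/-- Of two disjoint closed alternating trails that cannot be merged one dominates the other. -/
theorem IsExtendedComplete.dominates_or_dominates (hH : IsExtendedComplete H φ κ) {X Y : Set α}
    {F F' : Set β} (h : HasTrail H φ X F) (h' : HasTrail H φ Y F') (hXY : Disjoint X Y)
    (hno : ∀ F₁, ¬ HasTrail H φ (X ∪ Y) F₁) :
    (∃ c, Dominates H φ X F Y c) ∨ ∃ c, Dominates H φ Y F' X c := by
  classical
  -- For `x` and `y` of one class, twins of the edges leaving them permit an exchange.
  have hκ : ∀ x ∈ X, ∀ y ∈ Y, κ x ≠ κ y := by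
    intro x hx y hy hxy
    obtain ⟨e, u, p, hp⟩ := h.exists_isClosedTrail_cons hx 0
    obtain ⟨f, v, q, hq⟩ := h'.exists_isClosedTrail_cons hy 0
    obtain ⟨g, hg, hgc⟩ := hH.twin hq.walk.1 (h.subset hx) hxy
    obtain ⟨g', hg', hgc'⟩ := hH.twin hp.walk.1 (h'.subset hy) hxy.symm
    obtain ⟨F₁, hF₁⟩ := hp.exchange hq hXY (hH.vertex_ne hp.walk.1) hg (hgc.trans hq.walk.2.1) hg'
      (hgc'.trans hp.walk.2.1)
    exact hno F₁ hF₁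
  have hadj : ∀ x ∈ X, ∀ y ∈ Y, ∃ e, H.IsLink e x y := fun x hx y hy =>
    hH.adj (h.subset hx) (h'.subset hy) (hκ x hx y hy)
  -- Two parallel edges of different colours form a closed alternating trail that bridges `X` and
  -- `Y`.
  have hsingle : ∀ x ∈ X, ∀ y ∈ Y, ∀ e f, H.IsLink e x y → H.IsLink f x y → φ f = φ e := by
    intro x hx y hy e f he hf
    by_contra hne
    have hc := eq_add_one_of_ne hne
    have hU : HasTrail H φ {y, x} {e, f} := by
      refine ⟨x, φ e, [(e, y), (f, x)], by simp, ?_, ?_, by simp, by simp⟩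
      · simp only [AltWalk, add_one_add_one]
        exact ⟨he, trivial, hf.symm, hc, he.left_mem, trivial, trivial⟩
      · simpa using ne_of_colour rfl hc
    obtain ⟨F₁, hF₁⟩ := hU.bridge_of_cross h h' hXY
      (by rintro _ (rfl | rfl) <;> exact ⟨x, hx, y, hy, by assumption⟩)
      (by rintro _ (rfl | rfl) <;> simp [hx, hy]) (u := x) (v := y) (by simp) hx (by simp) hy
    exact hno F₁ hF₁
  obtain ⟨col, hcol⟩ : ∃ col : α → α → Fin 2, ∀ x ∈ X, ∀ y ∈ Y,
      (∃ e, H.IsLink e x y) ∧ ∀ e, H.IsLink e x y → φ e = col x y := by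
    refine ⟨fun x y => if hxy : ∃ e, H.IsLink e x y then φ hxy.choose else 0, ?_⟩
    intro x hx y hy
    have hxy := hadj x hx y hy
    refine ⟨hxy, fun e he => ?_⟩
    simp only [dif_pos hxy]
    exact hsingle x hx y hy _ _ hxy.choose_spec he
  have hfour : ∀ x ∈ X, ∀ x' ∈ X, ∀ y ∈ Y, ∀ y' ∈ Y, col x y ≠ col x' y →
      col x' y ≠ col x' y' → col x' y' ≠ col x y' → col x y' = col x y := by
    intro x hx x' hx' y hy y' hy' h1 h2 h3
    by_contra h4
    obtain ⟨⟨e₁, he₁⟩, hc₁⟩ := hcol x hx y hy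
    obtain ⟨⟨e₂, he₂⟩, hc₂⟩ := hcol x' hx' y hy
    obtain ⟨⟨e₃, he₃⟩, hc₃⟩ := hcol x' hx' y' hy'
    obtain ⟨⟨e₄, he₄⟩, hc₄⟩ := hcol x hx y' hy'
    have hxx : x ≠ x' := by rintro rfl; exact h1 rfl
    have hxy : x ≠ y' := fun h5 => Set.disjoint_left.1 hXY hx (h5 ▸ hy')
    have hxy' : x' ≠ y' := fun h5 => Set.disjoint_left.1 hXY hx' (h5 ▸ hy')
    have c₂ := eq_add_one_of_ne h1.symm
    have c₃ := eq_add_one_of_ne h2.symm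
    have c₄ := eq_add_one_of_ne h4
    rw [c₂, add_one_add_one] at c₃
    have hU := hasTrail_four_cycle he₁ he₂.symm he₃ he₄.symm (hc₁ _ he₁)
      ((hc₂ _ he₂).trans c₂) ((hc₃ _ he₃).trans c₃) ((hc₄ _ he₄).trans c₄)
      (ne_of_isLink he₁ he₃ hxx hxy) (ne_of_isLink he₂ he₄ hxx.symm hxy')
    obtain ⟨F₁, hF₁⟩ := hU.bridge_of_cross h h' hXY
      (by
        rintro _ (rfl | rfl | rfl | rfl)
        · exact ⟨x, hx, y, hy, he₁⟩
        · exact ⟨x', hx', y, hy, he₂⟩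
        · exact ⟨x', hx', y', hy', he₃⟩
        · exact ⟨x, hx, y', hy', he₄⟩)
      (by rintro _ (rfl | rfl | rfl | rfl) <;> simp [*]) (u := x) (v := y) (by simp) hx (by simp) hy
    exact hno F₁ hF₁
  obtain ⟨M, x, c, hM, hxM, hcM, hc, hx, hxF, hxT⟩ := h.exists_sequence
  obtain ⟨N, y, d, hN, hyN, hdN, hd, hy, hyF, hyT⟩ := h'.exists_sequence
  have hxX : ∀ i, x i ∈ X := fun i => by
    obtain ⟨e, q, hq⟩ := hxT i
    exact hq.start_mem
  have hyY : ∀ i, y i ∈ Y := fun i => by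
    obtain ⟨e, q, hq⟩ := hyT i
    exact hq.start_mem
  have hNM : ∀ i : ℤ, i + ((M * N : ℕ) : ℤ) = i + (N : ℕ) * (M : ℤ) := fun i => by push_cast; ring
  have hMN : ∀ i : ℤ, i + ((M * N : ℕ) : ℤ) = i + (M : ℕ) * (N : ℤ) := fun i => by push_cast; ring
  have hdMN : ∀ j, d (j + ((M * N : ℕ) : ℤ)) = d j := fun j => by rw [hMN, apply_add_mul hdN]
  -- The product of the two lengths is a common period.
  have hum : IsUnmergeable (fun i j => col (x i) (y j)) c d (M * N) := by
    refine ⟨Nat.mul_pos hM hN, fun i j => ?_, fun i j => ?_, hc, hd, fun i => ?_,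
      fun i j hij h1 h2 => ?_, fun i j hij h1 h2 => ?_, fun i i' j j' => ?_⟩
    · simp only [hNM, apply_add_mul hxM]
    · simp only [hMN, apply_add_mul hyN]
    · rw [hNM, apply_add_mul hcM]
    · obtain ⟨e, p, hp⟩ := hxT i
      obtain ⟨f, q, hq⟩ := hyT j
      rw [← hij] at hq
      obtain ⟨⟨g, hg⟩, hgc⟩ := hcol _ (hxX i) _ (hyY j)
      obtain ⟨⟨g', hg'⟩, hgc'⟩ := hcol _ (hxX (i + 1)) _ (hyY (j + 1))
      obtain ⟨F₁, hF₁⟩ := hp.exchange hq.reverse_cons hXY (hH.vertex_ne hp.walk.1) hg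
        ((hgc g hg).trans h1) hg'.symm ((hgc' g' hg').trans h2)
      exact hno F₁ hF₁
    · obtain ⟨e, p, hp⟩ := hxT i
      obtain ⟨f, q, hq⟩ := hyT j
      rw [← hij] at hq
      obtain ⟨⟨g, hg⟩, hgc⟩ := hcol _ (hxX i) _ (hyY (j + 1))
      obtain ⟨⟨g', hg'⟩, hgc'⟩ := hcol _ (hxX (i + 1)) _ (hyY j)
      obtain ⟨F₁, hF₁⟩ := hp.exchange hq hXY (hH.vertex_ne hp.walk.1) hg
        ((hgc g hg).trans h1) hg'.symm ((hgc' g' hg').trans h2)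
      exact hno F₁ hF₁
    · exact hfour _ (hxX i) _ (hxX i') _ (hyY j) _ (hyY j')
  rcases hum.eq_left_or_eq_right hdMN with ⟨a, ha⟩ | ⟨a, ha⟩
  · refine Or.inl ⟨_, dominates_of_sequence (hyY 0) hc hx hxF hcol (a := a) fun i w hw => ?_⟩
    obtain ⟨j, rfl⟩ := hy w hw
    exact ha i j
  · refine Or.inr ⟨_, dominates_of_sequence (col := fun y x => col x y) (hxX 0) hd hy hyF
      (fun y hy x hx => ?_) (a := a) fun j w hw => ?_⟩
    · obtain ⟨⟨e, he⟩, h1⟩ := hcol x hx y hy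
      exact ⟨⟨e, he.symm⟩, fun e he => h1 e he.symm⟩
    · obtain ⟨i, rfl⟩ := hx w hw
      exact ha i j

end Domination

/-! ### Families of disjoint trails: finding a dominating one and merging. -/

section Families

/-- A finite set with a total relation without directed 3-cycles has a source. -/
lemma exists_source {δ : Type*} {r : δ → δ → Prop} (s : Finset δ) (hs : s.Nonempty)
    (htot : ∀ x ∈ s, ∀ y ∈ s, x ≠ y → r x y ∨ r y x)
    (hcyc : ∀ x ∈ s, ∀ y ∈ s, ∀ z ∈ s, x ≠ y → x ≠ z → y ≠ z → r x y → r y z → ¬ r z x) :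
    ∃ m ∈ s, ∀ x ∈ s, x ≠ m → r m x := by
  classical
  induction hs using Finset.Nonempty.cons_induction with
  | singleton a => exact ⟨a, by simp, by simp⟩
  | cons a s ha hs ih =>
    simp only [Finset.mem_cons] at htot hcyc
    obtain ⟨m, hm, hmax⟩ := ih (fun x hx y hy => htot x (.inr hx) y (.inr hy))
      (fun x hx y hy z hz => hcyc x (.inr hx) y (.inr hy) z (.inr hz))
    have hne : ∀ x ∈ s, a ≠ x := fun x hx h => ha (h ▸ hx)
    rcases htot m (.inr hm) a (.inl rfl) (hne m hm).symm with h | h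
    · refine ⟨m, by simp [hm], fun x hx hxm => ?_⟩
      rcases Finset.mem_cons.1 hx with rfl | hx
      · exact h
      · exact hmax x hx hxm
    · refine ⟨a, by simp, fun x hx hxa => ?_⟩
      rcases Finset.mem_cons.1 hx with rfl | hx
      · exact absurd rfl hxa
      · by_cases hxm : x = m
        · exact hxm ▸ h
        · refine (htot a (.inl rfl) x (.inr hx) hxa.symm).resolve_right ?_
          exact hcyc a (.inl rfl) m (.inr hm) x (.inr hx) (hne m hm) hxa.symm (Ne.symm hxm) h
            (hmax x hx hxm)

variable {α β γ : Type*} {H : Graph α β} {φ : β → Fin 2} {κ : α → γ}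
  {X Y Z : Set α} {F F' F'' : Set β} {c c' c'' : α → Fin 2}

/-- Both colours occur because `c` changes along each edge of the trail. -/
lemma Dominates.exists_colour (h : Dominates H φ X F Y c) (hX : HasTrail H φ X F) (a : Fin 2) :
    ∃ x ∈ X, c x = a := by
  obtain ⟨x, hx⟩ := hX.nonempty
  obtain ⟨e, w, q, hq⟩ := hX.exists_isClosedTrail_cons hx 0
  have h1 := h.2 e ((hq.edge_iff e).1 (by simp)) x w hq.walk.1
  rcases eq_or_eq_add_one a (c x) with rfl | rfl
  · exact ⟨x, hx, rfl⟩
  · exact ⟨w, (hq.mem_iff w).1 (by simp), h1⟩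

/-- Three closed alternating trails that dominate each other cyclically are merged by an
alternating 6-cycle. -/
lemma hasTrail_of_cyclic_domination (hX : HasTrail H φ X F) (hY : HasTrail H φ Y F')
    (hZ : HasTrail H φ Z F'') (hXY : Disjoint X Y) (hXZ : Disjoint X Z) (hYZ : Disjoint Y Z)
    (h : Dominates H φ X F Y c) (h' : Dominates H φ Y F' Z c') (h'' : Dominates H φ Z F'' X c'') :
    ∃ F₁, HasTrail H φ (X ∪ Y ∪ Z) F₁ := by
  -- The 6-cycle is x y z x' y' z'. Each edge has the colour of its dominating tail, and these are
  -- chosen as 0, 1, 0, 1, 0, 1.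
  obtain ⟨x, hx, hcx⟩ := h.exists_colour hX 0
  obtain ⟨x', hx', hcx'⟩ := h.exists_colour hX 1
  obtain ⟨y, hy, hcy⟩ := h'.exists_colour hY 1
  obtain ⟨y', hy', hcy'⟩ := h'.exists_colour hY 0
  obtain ⟨z, hz, hcz⟩ := h''.exists_colour hZ 0
  obtain ⟨z', hz', hcz'⟩ := h''.exists_colour hZ 1
  obtain ⟨⟨e₁, l₁⟩, k₁⟩ := h.1 x hx y hy
  obtain ⟨⟨e₂, l₂⟩, k₂⟩ := h'.1 y hy z hz
  obtain ⟨⟨e₃, l₃⟩, k₃⟩ := h''.1 z hz x' hx'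
  obtain ⟨⟨e₄, l₄⟩, k₄⟩ := h.1 x' hx' y' hy'
  obtain ⟨⟨e₅, l₅⟩, k₅⟩ := h'.1 y' hy' z' hz'
  obtain ⟨⟨e₆, l₆⟩, k₆⟩ := h''.1 z' hz' x hx
  replace k₁ := (k₁ _ l₁).trans hcx
  replace k₂ := (k₂ _ l₂).trans hcy
  replace k₃ := (k₃ _ l₃).trans hcz
  replace k₄ := (k₄ _ l₄).trans hcx'
  replace k₅ := (k₅ _ l₅).trans hcy'
  replace k₆ := (k₆ _ l₆).trans hcz'
  have nXY : ∀ {u v}, u ∈ X → v ∈ Y → u ≠ v := fun h1 h2 h3 =>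
    Set.disjoint_left.1 hXY h1 (h3 ▸ h2)
  have nXZ : ∀ {u v}, u ∈ X → v ∈ Z → u ≠ v := fun h1 h2 h3 =>
    Set.disjoint_left.1 hXZ h1 (h3 ▸ h2)
  have nYZ : ∀ {u v}, u ∈ Y → v ∈ Z → u ≠ v := fun h1 h2 h3 =>
    Set.disjoint_left.1 hYZ h1 (h3 ▸ h2)
  have hcol : ∀ {e f}, φ e = 0 → φ f = 1 → e ≠ f := fun h1 h2 => ne_of_colour h1 h2
  have hU : HasTrail H φ {y, z, x', y', z', x} {e₁, e₂, e₃, e₄, e₅, e₆} := by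
    refine ⟨x, 0, [(e₁, y), (e₂, z), (e₃, x'), (e₄, y'), (e₅, z'), (e₆, x)], by simp, ?_, ?_,
      by simp, by simp⟩
    · simp only [AltWalk, add_one_add_one]
      exact ⟨l₁, k₁, l₂, k₂, l₃, k₃, l₄, k₄, l₅, k₅, l₆, k₆, l₁.left_mem, trivial, trivial⟩
    · simp [hcol k₁ k₂, hcol k₁ k₄, hcol k₁ k₆, hcol k₃ k₄, hcol k₃ k₆, (hcol k₃ k₂).symm,
        (hcol k₅ k₂).symm, (hcol k₅ k₄).symm, hcol k₅ k₆,
        ne_of_isLink l₁.symm l₃ (nYZ hy hz) (nXY hx' hy).symm,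
        ne_of_isLink l₁ l₅ (nXY hx hy') (nXZ hx hz'),
        ne_of_isLink l₃.symm l₅ (nXY hx' hy') (nXZ hx' hz'),
        ne_of_isLink l₂.symm l₄ (nXZ hx' hz).symm (nYZ hy' hz).symm,
        ne_of_isLink l₂ l₆ (nYZ hy hz') (nXY hx hy).symm,
        ne_of_isLink l₄.symm l₆ (nYZ hy' hz') (nXY hx hy').symm]
  refine hU.bridge_three hX hY hZ hXY hXZ hYZ ?_ ?_ (u := x) (v := y) (w := z) (by simp) hx
    (by simp) hy (by simp) hz
  · rintro _ (rfl | rfl | rfl | rfl | rfl | rfl)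
    · exact ⟨x, y, l₁, by tauto⟩
    · exact ⟨y, z, l₂, by tauto⟩
    · exact ⟨x', z, l₃.symm, by tauto⟩
    · exact ⟨x', y', l₄, by tauto⟩
    · exact ⟨y', z', l₅, by tauto⟩
    · exact ⟨x, z', l₆.symm, by tauto⟩
  · rintro _ (rfl | rfl | rfl | rfl | rfl | rfl) <;> simp [*]

/-- If a closed alternating trail dominates two others with different colours, then the three are
merged by an alternating 4-cycle. -/
lemma hasTrail_of_dominates_ne (hX : HasTrail H φ X F) (hY : HasTrail H φ Y F')
    (hZ : HasTrail H φ Z F'') (hXY : Disjoint X Y) (hXZ : Disjoint X Z) (hYZ : Disjoint Y Z)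
    (h : Dominates H φ X F Y c) (h' : Dominates H φ X F Z c') {x : α} (hx : x ∈ X)
    (hne : c' x ≠ c x) : ∃ F₁, HasTrail H φ (X ∪ Y ∪ Z) F₁ := by
  have hc := eq_add_one_of_ne hne
  obtain ⟨y, hy⟩ := hY.nonempty
  obtain ⟨z, hz⟩ := hZ.nonempty
  -- At a trail neighbour `x'` of `x` both colour functions are flipped, so x y x' z is an
  -- alternating 4-cycle.
  obtain ⟨e, x', q, hq⟩ := hX.exists_isClosedTrail_cons hx 0
  have hx' : x' ∈ X := (hq.mem_iff x').1 (by simp)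
  have he := (hq.edge_iff e).1 (by simp)
  have hc1 := h.2 e he x x' hq.walk.1
  have hc2 := h'.2 e he x x' hq.walk.1
  rw [hc, add_one_add_one] at hc2
  obtain ⟨⟨e₁, l₁⟩, k₁⟩ := h.1 x hx y hy
  obtain ⟨⟨e₂, l₂⟩, k₂⟩ := h.1 x' hx' y hy
  obtain ⟨⟨e₃, l₃⟩, k₃⟩ := h'.1 x' hx' z hz
  obtain ⟨⟨e₄, l₄⟩, k₄⟩ := h'.1 x hx z hz
  have nY : ∀ {u}, u ∈ X → y ≠ u := fun h1 h3 => Set.disjoint_left.1 hXY h1 (h3 ▸ hy)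
  have nYZ : y ≠ z := fun h3 => Set.disjoint_left.1 hYZ hy (h3 ▸ hz)
  have hU := hasTrail_four_cycle l₁ l₂.symm l₃ l₄.symm (k₁ _ l₁) ((k₂ _ l₂).trans hc1)
    ((k₃ _ l₃).trans hc2) ((k₄ _ l₄).trans hc) (ne_of_isLink l₁.symm l₃ (nY hx') nYZ)
    (ne_of_isLink l₂.symm l₄ (nY hx) nYZ)
  refine hU.bridge_three hX hY hZ hXY hXZ hYZ ?_ ?_ (u := x) (v := y) (w := z) (by simp) hx
    (by simp) hy (by simp) hz
  · rintro _ (rfl | rfl | rfl | rfl)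
    · exact ⟨x, y, l₁, by tauto⟩
    · exact ⟨x', y, l₂, by tauto⟩
    · exact ⟨x', z, l₃, by tauto⟩
    · exact ⟨x, z, l₄, by tauto⟩
  · rintro _ (rfl | rfl | rfl | rfl) <;> simp [*]

/-- A closed alternating trail on `Y` is rerouted over an edge `e` with both ends in the dominating
set `X`. -/
lemma hasTrail_of_chord (hH : IsExtendedComplete H φ κ) (hX : HasTrail H φ X F)
    (hY : HasTrail H φ Y F') (hXY : Disjoint X Y) (h : Dominates H φ X F Y c) {x x' : α} {e : β}
    (hx : x ∈ X) (hx' : x' ∈ X) (he : H.IsLink e x x') (hc : c x' = c x) (hec : φ e = c x + 1) :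
    ∃ F₁, HasTrail H φ (X ∪ Y) F₁ := by
  obtain ⟨y, hy⟩ := hY.nonempty
  -- The edge `f` from `y` to `y'` has colour `c x`. It is replaced by the path y x x' y', whose
  -- first and last edges have this colour as well.
  obtain ⟨f, y', q, hq⟩ := hY.exists_isClosedTrail_cons hy (c x)
  have hy' : y' ∈ Y := (hq.mem_iff y').1 (by simp)
  have hyy : y ≠ y' := hH.vertex_ne hq.walk.1
  obtain ⟨⟨g, hg⟩, hgc⟩ := h.1 x hx y hy
  obtain ⟨⟨g', hg'⟩, hgc'⟩ := h.1 x' hx' y' hy'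
  have kg := hgc _ hg
  have kg' := (hgc' _ hg').trans hc
  have hYn : ∀ {y}, y ∈ Y → y ∉ X := fun h1 h2 => Set.disjoint_left.1 hXY h2 h1
  have hXn : ∀ {x}, x ∈ X → x ∉ Y := fun h1 => Set.disjoint_left.1 hXY h1
  have hgg : g ≠ g' := ne_of_isLink hg.symm hg' (fun h3 => hYn hy (h3 ▸ hx')) hyy
  have hqF : ∀ k ∈ q.map Prod.fst, k ∈ F' := fun k hk => (hq.edge_iff k).1 (by simp [hk])
  have hn := hq.nodup
  rw [List.map_cons, List.nodup_cons] at hn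
  have hgY : g ∉ q.map Prod.fst := fun hk =>
    hY.notMem_edges hg (Or.inl (hXn hx)) (hqF _ hk)
  have hgY' : g' ∉ q.map Prod.fst := fun hk =>
    hY.notMem_edges hg' (Or.inl (hXn hx')) (hqF _ hk)
  have heY : e ∉ q.map Prod.fst := fun hk =>
    hY.notMem_edges he (Or.inl (hXn hx)) (hqF _ hk)
  have heX : e ∉ F := fun hk => add_one_ne (c x) ((h.2 e hk x x' he).symm.trans hc)
  have hw : AltWalk H φ y (c x) ((g, x) :: (e, x') :: (g', y') :: q) y (c x) := by
    refine ⟨hg.symm, kg, he, hec, hg', ?_, ?_⟩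
    · rw [kg', add_one_add_one]
    · rw [add_one_add_one]
      exact hq.walk.2.2
  have hT := hw.hasTrail (by simp) (by
    simp only [List.map_cons, List.nodup_cons, List.mem_cons, not_or]
    exact ⟨⟨ne_of_colour kg hec, hgg, hgY⟩, ⟨(ne_of_colour kg' hec).symm, heY⟩, hgY', hn.2⟩)
  have hU := hT.union hX ?_ ⟨x, by simp, hx⟩
  · have hset : {w | w ∈ ((g, x) :: (e, x') :: (g', y') :: q).map Prod.snd} ∪ X = X ∪ Y := by
      ext w
      have h1 := hq.mem_iff w
      simp only [List.map_cons, List.mem_cons] at h1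
      simp only [Set.mem_union, Set.mem_ofPred_eq, List.map_cons, List.mem_cons, h1]
      constructor
      · rintro ((rfl | rfl | h2) | h2)
        · exact .inl hx
        · exact .inl hx'
        · exact .inr h2
        · exact .inl h2
      · rintro (h2 | h2)
        · exact .inr h2
        · exact .inl (.inr (.inr h2))
    exact ⟨_, hset ▸ hU⟩
  · rw [Set.disjoint_left]
    intro k hk
    rcases List.mem_cons.1 hk with rfl | hk
    · exact hX.notMem_edges hg (Or.inr (hYn hy))
    rcases List.mem_cons.1 hk with rfl | hk
    · exact heX
    rcases List.mem_cons.1 hk with rfl | hk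
    · exact hX.notMem_edges hg' (Or.inr (hYn hy'))
    · exact fun hk' => Set.disjoint_left.1 (hX.disjoint_edges hY hXY) hk' (hqF _ hk)

/-- If a vertex `v` of `X` is entered by an alternating walk from outside with the colour other than `c v`,
then some edge inside `X` does not fit the colours of its ends. -/
lemma AltWalk.exists_chord {u v : α} {a b : Fin 2} {p : List (β × α)}
    (hout : ∀ x ∈ X, ∀ y, y ∉ X → ∀ e, H.IsLink e x y → φ e = c x)
    (hp : AltWalk H φ u a p v b) (hu : u ∈ X → a = c u + 1) (hv : v ∈ X) (hb : b = c v) :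
    ∃ x ∈ X, ∃ x' ∈ X, ∃ e, H.IsLink e x x' ∧ c x' = c x ∧ φ e = c x + 1 := by
  -- The invariant is that the walk leaves a vertex `x` of `X` with colour `c x + 1`. Entering `X`
  -- from outside establishes it, and an inner edge along which `c` changes preserves it. The end of
  -- the walk violates it, so some inner edge joins vertices with equal `c`.
  induction p generalizing u a with
  | nil =>
    obtain ⟨_, rfl, rfl⟩ := hp
    exact absurd ((hu hv).symm.trans hb) (add_one_ne _)
  | cons d p ih =>
    obtain ⟨h1, h2, h3⟩ := hp
    by_cases hd : d.2 ∈ X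
    · by_cases hu' : u ∈ X
      · rcases eq_or_eq_add_one (c d.2) (c u) with h4 | h4
        · exact ⟨u, hu', d.2, hd, d.1, h1, h4, h2.trans (hu hu')⟩
        · exact ih h3 fun _ => by rw [h4, hu hu']
      · refine ih h3 fun _ => ?_
        rw [← h2, hout _ hd u hu' _ h1.symm]
    · exact ih h3 fun h4 => absurd h4 hd

/-- A family of disjoint closed alternating trails that covers the vertices and cannot be coarsened
has only one member. -/
theorem IsExtendedComplete.card_le_one (hH : IsExtendedComplete H φ κ) (P : Finset (Set α))
    (hP : ∀ X ∈ P, ∃ F, HasTrail H φ X F) (hdisj : ∀ X ∈ P, ∀ Y ∈ P, X ≠ Y → Disjoint X Y)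
    (hcov : ∀ x ∈ V(H), ∃ X ∈ P, x ∈ X)
    (hcc : ∀ x ∈ V(H), ∀ y ∈ V(H), x ≠ y → ∀ b, ∃ a p, AltWalk H φ y a p x b)
    (hirr : ∀ S ⊆ P, 1 < S.card → ∀ F₁, ¬ HasTrail H φ (⋃₀ (S : Set (Set α))) F₁) :
    P.card ≤ 1 := by
  classical
  by_contra! hcard
  have htwo : ∀ X ∈ P, ∀ Y ∈ P, X ≠ Y → ∀ F₁, ¬ HasTrail H φ (X ∪ Y) F₁ := by
    intro X hX Y hY hne F₁ hF₁
    refine hirr {X, Y} ?_ ?_ F₁ (by simpa using hF₁)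
    · intro Z hZ
      rcases Finset.mem_insert.1 hZ with rfl | hZ
      · exact hX
      · rwa [Finset.mem_singleton.1 hZ]
    · rw [Finset.card_pair hne]; norm_num
  have hthree : ∀ X ∈ P, ∀ Y ∈ P, ∀ Z ∈ P, X ≠ Y → X ≠ Z → Y ≠ Z →
      ∀ F₁, ¬ HasTrail H φ (X ∪ Y ∪ Z) F₁ := by
    intro X hX Y hY Z hZ h1 h2 h3 F₁ hF₁
    refine hirr {X, Y, Z} ?_ ?_ F₁ (by simpa [Set.union_assoc] using hF₁)
    · intro W hW
      simp only [Finset.mem_insert, Finset.mem_singleton] at hW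
      rcases hW with rfl | rfl | rfl <;> assumption
    · rw [Finset.card_eq_three.2 ⟨X, Y, Z, h1, h2, h3, rfl⟩]; norm_num
  choose! F hF using hP
  obtain ⟨X, hX, hdom⟩ := exists_source (r := fun X Y => ∃ c, Dominates H φ X (F X) Y c) P
    (Finset.card_pos.1 (by omega))
    (fun X hX Y hY hne => hH.dominates_or_dominates (hF X hX) (hF Y hY) (hdisj X hX Y hY hne)
      (htwo X hX Y hY hne))
    (by
      rintro X hX Y hY Z hZ h1 h2 h3 ⟨c, hc⟩ ⟨c', hc'⟩ ⟨c'', hc''⟩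
      obtain ⟨F₁, hF₁⟩ := hasTrail_of_cyclic_domination (hF X hX) (hF Y hY) (hF Z hZ)
        (hdisj X hX Y hY h1) (hdisj X hX Z hZ h2) (hdisj Y hY Z hZ h3) hc hc' hc''
      exact hthree X hX Y hY Z hZ h1 h2 h3 F₁ hF₁)
  obtain ⟨Y, hY, hYX⟩ := Finset.exists_mem_ne hcard X
  obtain ⟨c, hc⟩ := hdom Y hY hYX
  have hout : ∀ x ∈ X, ∀ y, y ∉ X → ∀ e, H.IsLink e x y → φ e = c x := by
    intro x hx y hy e he
    obtain ⟨Z, hZ, hyZ⟩ := hcov y he.right_mem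
    have hZX : Z ≠ X := by rintro rfl; exact hy hyZ
    by_cases hZY : Z = Y
    · subst hZY
      exact (hc.1 x hx y hyZ).2 e he
    · obtain ⟨c', hc'⟩ := hdom Z hZ hZX
      -- `X` dominates `Y` and `Z` with the same colours, as otherwise the three trails merge.
      rw [(hc'.1 x hx y hyZ).2 e he]
      by_contra hne
      obtain ⟨F₁, hF₁⟩ := hasTrail_of_dominates_ne (hF X hX) (hF Y hY) (hF Z hZ)
        (hdisj X hX Y hY hYX.symm) (hdisj X hX Z hZ hZX.symm) (hdisj Y hY Z hZ (Ne.symm hZY))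
        hc hc' hx hne
      exact hthree X hX Y hY Z hZ hYX.symm hZX.symm (Ne.symm hZY) F₁ hF₁
  obtain ⟨x, hx⟩ := (hF X hX).nonempty
  obtain ⟨y, hy⟩ := (hF Y hY).nonempty
  have hyX : y ∉ X := fun h => Set.disjoint_left.1 (hdisj X hX Y hY hYX.symm) h hy
  obtain ⟨a, p, hp⟩ := hcc x ((hF X hX).subset hx) y ((hF Y hY).subset hy)
    (fun h => hyX (h ▸ hx)) (c x)
  obtain ⟨v, hv, v', hv', e, he, hcv, hec⟩ :=
    hp.exists_chord hout (fun h => absurd h hyX) hx rfl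
  obtain ⟨F₁, hF₁⟩ := hasTrail_of_chord hH (hF X hX) (hF Y hY) (hdisj X hX Y hY hYX.symm) hc hv hv'
    he hcv hec
  exact htwo X hX Y hY hYX.symm F₁ hF₁

/-- If the vertices are covered by disjoint closed alternating trails, and any two vertices are
joined by alternating walks with both final colours, then there is a closed alternating trail through
all vertices. -/
theorem IsExtendedComplete.exists_hasTrail (hH : IsExtendedComplete H φ κ) (hV : V(H).Nonempty)
    (P : Finset (Set α)) (hP : ∀ X ∈ P, ∃ F, HasTrail H φ X F)
    (hdisj : ∀ X ∈ P, ∀ Y ∈ P, X ≠ Y → Disjoint X Y) (hcov : ∀ x ∈ V(H), ∃ X ∈ P, x ∈ X)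
    (hcc : ∀ x ∈ V(H), ∀ y ∈ V(H), x ≠ y → ∀ b, ∃ a p, AltWalk H φ y a p x b) :
    ∃ F, HasTrail H φ V(H) F := by
  classical
  induction hn : P.card using Nat.strong_induction_on generalizing P with
  | _ n ih =>
    by_cases hirr : ∀ S ⊆ P, 1 < S.card → ∀ F₁, ¬ HasTrail H φ (⋃₀ (S : Set (Set α))) F₁
    · have hcard := hH.card_le_one P hP hdisj hcov hcc hirr
      obtain ⟨x, hx⟩ := hV
      obtain ⟨X, hX, hxX⟩ := hcov x hx
      obtain ⟨F, hF⟩ := hP X hX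
      have : X = V(H) := by
        refine Set.Subset.antisymm hF.subset fun y hy => ?_
        obtain ⟨Y, hY, hyY⟩ := hcov y hy
        rwa [Finset.card_le_one.1 hcard X hX Y hY]
      exact ⟨F, this ▸ hF⟩
    · push Not at hirr
      obtain ⟨S, hSP, hS, F₁, hF₁⟩ := hirr
      have hdS : ∀ Y ∈ P \ S, Disjoint (⋃₀ (S : Set (Set α))) Y := by
        intro Y hY
        rw [Finset.mem_sdiff] at hY
        rw [Set.disjoint_sUnion_left]
        intro Z hZ
        exact hdisj Z (hSP hZ) Y hY.1 (by rintro rfl; exact hY.2 hZ)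
      refine ih _ ?_ (insert (⋃₀ (S : Set (Set α))) (P \ S)) ?_ ?_ ?_ rfl
      · have h1 := Finset.card_insert_le (⋃₀ (S : Set (Set α))) (P \ S)
        have h2 := Finset.card_sdiff_add_card_eq_card hSP
        omega
      · intro X hX
        rcases Finset.mem_insert.1 hX with rfl | hX
        · exact ⟨F₁, hF₁⟩
        · exact hP X (Finset.mem_sdiff.1 hX).1
      · intro X hX Y hY hne
        rcases Finset.mem_insert.1 hX with rfl | hX <;> rcases Finset.mem_insert.1 hY with rfl | hY
        · exact absurd rfl hne
        · exact hdS Y hY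
        · exact (hdS X hX).symm
        · exact hdisj X (Finset.mem_sdiff.1 hX).1 Y (Finset.mem_sdiff.1 hY).1 hne
      · intro x hx
        obtain ⟨X, hX, hxX⟩ := hcov x hx
        by_cases hXS : X ∈ S
        · exact ⟨_, Finset.mem_insert_self _ _, X, hXS, hxX⟩
        · exact ⟨X, Finset.mem_insert_of_mem (Finset.mem_sdiff.2 ⟨hX, hXS⟩), hxX⟩

end Families

/-! ### Both implications, and the passage to extensions. -/

section Main

variable {α β γ : Type*} {H : Graph α β} {φ : β → Fin 2} {κ : α → γ}

lemma Supereulerian.hasTrail (h : Supereulerian H φ) : ∃ F, HasTrail H φ V(H) F := by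
  obtain ⟨u, p, ⟨hw, hn⟩, ⟨ha, hc⟩, hv⟩ := h
  have hp : p ≠ [] := by rintro rfl; simp [colours] at hc
  obtain ⟨d, p, rfl⟩ := List.exists_cons_of_ne_nil hp
  obtain ⟨b, hb⟩ := exists_altWalk (a := φ d.1) hw ha (by simp [colours])
  rw [hb.head?_colours hp, hb.getLast?_colours hp] at hc
  have hba : b = φ d.1 := by
    have h1 : φ d.1 ≠ b + 1 := fun h => hc (by rw [← h])
    have := eq_add_one_of_ne h1
    rw [add_one_add_one] at this
    exact this.symm
  rw [hba] at hb
  exact ⟨_, u, _, _, hp, hb, hn, fun w => ⟨fun h => hb.snd_mem w h, hv w⟩, fun _ => Iff.rfl⟩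

lemma HasTrail.supereulerian {F : Set β} (h : HasTrail H φ V(H) F) : Supereulerian H φ := by
  obtain ⟨u, a, p, hp⟩ := h
  refine ⟨u, p, ⟨hp.walk.isWalk, hp.nodup⟩, ⟨hp.walk.alternates, ?_⟩,
    fun v hv => (hp.mem_iff v).2 hv⟩
  rw [hp.walk.head?_colours hp.ne_nil, hp.walk.getLast?_colours hp.ne_nil]
  exact fun h => add_one_ne a (Option.some.inj h).symm

lemma AltWalk.of_induce {X : Set α} (hX : X ⊆ V(H)) {u v : α} {a b : Fin 2} {p : List (β × α)}
    (h : AltWalk (H.induce X) φ u a p v b) : AltWalk H φ u a p v b := by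
  induction p generalizing u a with
  | nil => exact ⟨hX h.1, h.2⟩
  | cons d p ih => exact ⟨h.1.1, h.2.1, ih h.2.2⟩

lemma HasTrail.of_induce {X : Set α} {F : Set β} (hX : X ⊆ V(H))
    (h : HasTrail (H.induce X) φ X F) : HasTrail H φ X F := by
  obtain ⟨u, a, p, hp⟩ := h
  exact ⟨u, a, p, hp.ne_nil, hp.walk.of_induce hX, hp.nodup, hp.mem_iff, hp.edge_iff⟩

lemma Supereulerian.hasEulerianFactor (h : Supereulerian H φ) : HasEulerianFactor H φ := by
  refine ⟨1, fun _ => V(H), ?_, Set.iUnion_const _, fun _ => ?_⟩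
  · intro i j hij
    exact absurd (Subsingleton.elim i j) hij
  · have : H.induce V(H) = H := by
      refine Graph.ext rfl fun e x y => ?_
      exact ⟨fun h => h.1, fun h => ⟨h, h.left_mem, h.right_mem⟩⟩
    rwa [this]

lemma HasTrail.exists_altWalk_between {X : Set α} {F : Set β} (h : HasTrail H φ X F) {u v : α}
    (hu : u ∈ X) (hv : v ∈ X) (a : Fin 2) : ∃ p b, AltWalk H φ u a p v b := by
  obtain ⟨p, hp⟩ := h.exists_isClosedTrail hu a
  rw [← hp.mem_iff] at hv
  obtain ⟨d, hd, rfl⟩ := List.mem_map.1 hv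
  obtain ⟨s, t, rfl⟩ := List.append_of_mem hd
  rw [List.append_cons] at hp
  obtain ⟨x, b, h1, -⟩ := hp.walk.of_append hp.walk.left_mem
  obtain ⟨rfl, -⟩ := AltWalk.end_eq (e := d.1) (w := d.2) h1
  exact ⟨_, _, h1⟩

theorem IsExtendedComplete.colourConnected (hH : IsExtendedComplete H φ κ)
    (h : Supereulerian H φ) : ColourConnected H φ := by
  obtain ⟨F, hF⟩ := h.hasTrail
  have hreach : ∀ u ∈ V(H), ∀ v ∈ V(H), u ≠ v → ∀ a, ∃ b, PathReach H φ u a v b := by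
    intro u hu v hv huv a
    obtain ⟨p, b, hp⟩ := hF.exists_altWalk_between hu hv a
    exact hH.exists_pathReach huv.symm hp
  intro u hu v hv huv
  have hrow := hreach u hu v hv huv
  have hcolumn : ∀ b, ∃ a, PathReach H φ u a v b := by
    intro b
    obtain ⟨a, ha⟩ := hreach v hv u hu huv.symm (b + 1)
    refine ⟨a + 1, ?_⟩
    simpa [add_one_add_one] using ha.symm
  -- A 2×2 table with an entry in each row and each column contains one of its two diagonals.
  obtain ⟨b, ⟨p, hp, hpw, hpn⟩, q, hq, hqw, hqn⟩ :
      ∃ b, PathReach H φ u 0 v b ∧ PathReach H φ u 1 v (b + 1) := by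
    simp only [Fin.forall_fin_two, Fin.exists_fin_two] at hrow hcolumn ⊢
    have : (1 : Fin 2) + 1 = 0 := rfl
    rw [zero_add, this]
    tauto
  refine ⟨p, q, ⟨hpw.isWalk, hpn⟩, hpw.alternates, ⟨hqw.isWalk, hqn⟩, hqw.alternates, ?_, ?_⟩
  · refine List.isChain_append.2 ⟨hpw.alternates, ?_, ?_⟩
    · rw [List.isChain_reverse]
      exact hqw.alternates.imp fun _ _ h => h.symm
    · rw [hpw.getLast?_colours hp, List.head?_reverse, hqw.getLast?_colours hq]
      rintro x hx y hy
      rw [Option.mem_some_iff] at hx hy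
      rw [← hx, ← hy]
      exact (add_one_ne _).symm
  · have h1 : colours φ p ≠ [] := by simpa [colours] using hp
    have h2 : (colours φ q).reverse ≠ [] := by simpa [colours] using hq
    rw [List.head?_append_of_ne_nil _ h1, List.getLast?_append_of_ne_nil _ h2,
      List.getLast?_reverse, hpw.head?_colours hp, hqw.head?_colours hq]
    simp

/-- The two paths leave `x` with different colours, so their reverses arrive at `x` with both. -/
lemma ColourConnected.exists_altWalk (h : ColourConnected H φ) {x y : α} (hx : x ∈ V(H))
    (hy : y ∈ V(H)) (hxy : x ≠ y) (b : Fin 2) : ∃ a p, AltWalk H φ y a p x b := by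
  obtain ⟨p, q, ⟨hp, -⟩, hpa, ⟨hq, -⟩, hqa, -, hpq⟩ := h x hx y hy hxy
  have hne : ∀ {p : List (β × α)}, IsWalk H x p y → p ≠ [] := by
    rintro p hp rfl
    exact hxy hp.2
  obtain ⟨d, p, rfl⟩ := List.exists_cons_of_ne_nil (hne hp)
  obtain ⟨d', q, rfl⟩ := List.exists_cons_of_ne_nil (hne hq)
  have hdd : φ d.1 ≠ φ d'.1 := by
    rw [List.head?_append_of_ne_nil _ (by simp [colours]),
      List.getLast?_append_of_ne_nil _ (by simp [colours]), List.getLast?_reverse] at hpq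
    simpa [colours] using hpq
  obtain ⟨b₁, h₁⟩ := TwoEdgeColoured.exists_altWalk (a := φ d.1) hp hpa (by simp [colours])
  obtain ⟨b₂, h₂⟩ := TwoEdgeColoured.exists_altWalk (a := φ d'.1) hq hqa (by simp [colours])
  rcases eq_or_eq_add_one b (φ d.1 + 1) with rfl | hb
  · exact ⟨_, _, h₁.reverse⟩
  · have : b = φ d'.1 + 1 := by
      rw [hb, eq_add_one_of_ne hdd, add_one_add_one]
    exact ⟨_, _, this ▸ h₂.reverse⟩

/-- An extension of a complete graph is supereulerian if and only if it has an eulerian factor and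
is colour-connected. -/
theorem IsExtendedComplete.supereulerian_iff (hH : IsExtendedComplete H φ κ)
    (hV : V(H).Nonempty) :
    Supereulerian H φ ↔ HasEulerianFactor H φ ∧ ColourConnected H φ := by
  classical
  refine ⟨fun h => ⟨h.hasEulerianFactor, hH.colourConnected h⟩, ?_⟩
  rintro ⟨⟨k, X, hX, hU, hS⟩, hcc⟩
  have hsub : ∀ i, X i ⊆ V(H) := fun i => hU ▸ Set.subset_iUnion X i
  obtain ⟨F, hF⟩ := hH.exists_hasTrail hV (Finset.univ.image X)
    (by
      intro Y hY
      obtain ⟨i, -, rfl⟩ := Finset.mem_image.1 hY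
      obtain ⟨F, hF⟩ := (hS i).hasTrail
      exact ⟨F, HasTrail.of_induce (hsub i) hF⟩)
    (by
      intro Y hY Z hZ hne
      obtain ⟨i, -, rfl⟩ := Finset.mem_image.1 hY
      obtain ⟨j, -, rfl⟩ := Finset.mem_image.1 hZ
      exact hX fun hij => hne (by rw [hij]))
    (by
      intro x hx
      rw [← hU] at hx
      obtain ⟨i, hi⟩ := Set.mem_iUnion.1 hx
      exact ⟨X i, by simp, hi⟩)
    (fun x hx y hy hxy b => hcc.exists_altWalk hx hy hxy b)
  exact hF.supereulerian

lemma isExtendedComplete_extension {G : Graph α β} (φ : β → Fin 2) (hG : IsComplete G) (p : α → ℕ) :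
    IsExtendedComplete (extension G p) (extensionColouring φ p) Sigma.fst where
  ne {e x y} h h' := by
    have := hG.1
    exact this.not_isLoopAt e.1 x.1 (by have h2 := h.2; rwa [← h'] at h2)
  adj {x y} hx hy hne := by
    obtain ⟨e, he⟩ := hG.2 x.1 hx y.1 hy hne
    exact ⟨(e, s(x, y)), rfl, he⟩
  twin {e x y z} h hz hzx := ⟨(e.1, s(z, y)), ⟨rfl, by rw [hzx]; exact h.2⟩, rfl⟩

end Main

end TwoEdgeColoured

theorem mainTheorem3 {α β : Type*} (G : Graph α β) (φ : β → Fin 2)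
    (hV : V(G).Finite) (hE : E(G).Finite) (hn : V(G).Nontrivial)
    (hG : TwoEdgeColoured.IsComplete G)
    (p : α → ℕ) (hp : ∀ v ∈ V(G), 1 ≤ p v) :
    TwoEdgeColoured.Supereulerian (TwoEdgeColoured.extension G p)
        (TwoEdgeColoured.extensionColouring φ p) ↔
      TwoEdgeColoured.HasEulerianFactor (TwoEdgeColoured.extension G p)
          (TwoEdgeColoured.extensionColouring φ p) ∧
        TwoEdgeColoured.ColourConnected (TwoEdgeColoured.extension G p)
          (TwoEdgeColoured.extensionColouring φ p) := by
  obtain ⟨v, hv⟩ := hn.nonempty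
  exact (TwoEdgeColoured.isExtendedComplete_extension φ hG p).supereulerian_iff
    ⟨⟨v, ⟨0, hp v hv⟩⟩, hv⟩
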